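/- Let $n\ge 0$. Let $\mathbb{AS}(n,\mathbb C)$ be the space of complex $n\times n$ matrices $X$ with $X^t=-X$, and for such $X$ let $\mathcal A_X=\{B^tXB : B \text{ an invertible upper-triangular complex } n\times n \text{ matrix}\}$ be its congruence B-orbit. Zariski closures $\overline{S}$ are taken in $\mathbb C^{n^2}$. Let $r_{k\ell}$ be the rank of the upper-left $k\times\ell$ submatrix of $X$ for $1\le k,\ell\le n$ (the rank-control matrix $R(X)$), put $r_{0\ell}=0$, and set $$\mathfrak A(X)=\#\{(i,j) : 1\le i<j\le n,\ r_{ij}=r_{i-1,j-1}\}.$$ An involution $\pi\in S_n$ (that is, $\pi^2=1$; the identity is allowed) is identified with the anti-symmetric matrix that has, for each $i<j$ with $\pi(i)=j$, the entry $1$ at $(i,j)$ and $-1$ at $(j,i)$, and zeros elsewhere. (1) For every involution $\pi\in S_n$, $$\dim\overline{\mathcal A_\pi}=\frac{n^2-n}{2}-\mathfrak A(\pi).$$ (2) The congruence B-orbits of matrices in $\mathbb{AS}(n,\mathbb C)$, ordered by $\mathcal O_1\le\mathcal O_2\iff\mathcal O_1\subseteq\overline{\mathcal O_2}$, form a graded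 poset with rank function $$\rho(\mathcal A_X)=\dim\overline{\mathcal A_X}=\frac{n^2-n}{2}-\mathfrak A(X)\qquad (X\in\mathbb{AS}(n,\mathbb C)),$$ that is, $\rho$ is strictly increasing, takes the value $0$ at minimal elements, and increases by exactly $1$ along every covering relation. -/

import Mathlib

open scoped Matrix

noncomputable section

/-- The set of anti-symmetric `n × n` complex matrices. -/
def antiSymmetricMatrices (n : ℕ) : Set (Matrix (Fin n) (Fin n) ℂ) :=
  {X | Xᵀ = -X}

/-- The group of invertible upper-triangular `n × n` complex matrices, as a set of matrices. -/
def borelMatrices (n : ℕ) : Set (Matrix (Fin n) (Fin n) ℂ) :=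
  {B | B.IsUpperTriangular ∧ IsUnit B}

/-- The congruence B-orbit `{Bᵀ X B}` of a matrix `X`. -/
def congruenceBOrbit {n : ℕ} (X : Matrix (Fin n) (Fin n) ℂ) : Set (Matrix (Fin n) (Fin n) ℂ) :=
  {Y | ∃ B ∈ borelMatrices n, Y = Bᵀ * X * B}

/-- The monomial anti-symmetric matrix of an involution `π`: for each transposition `(i, j)` of
`π` with `i < j` there is `1` at the position `(i, j)` and `-1` at the position `(j, i)`; all
other entries are zero. -/
def involutionMatrix {n : ℕ} (π : Equiv.Perm (Fin n)) : Matrix (Fin n) (Fin n) ℂ :=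
  Matrix.of fun i j => if π i = j then (if i < j then 1 else if j < i then -1 else 0) else 0

theorem involutionMatrix_mem {n : ℕ} {π : Equiv.Perm (Fin n)} (h : π * π = 1) :
    involutionMatrix π ∈ antiSymmetricMatrices n := by
  have hh : ∀ x, π (π x) = x := fun x => by
    simpa using congrArg (fun σ : Equiv.Perm (Fin n) => σ x) h
  ext i j
  have e : π j = i ↔ π i = j := ⟨fun k => by rw [← k, hh], fun k => by rw [← k, hh]⟩
  simp only [involutionMatrix, Matrix.transpose_apply, Matrix.of_apply, Matrix.neg_apply, e]
  rcases lt_trichotomy i j with k | k | k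
  · simp only [k, k.not_gt, if_true, if_false]; split_ifs <;> simp
  · simp [k]
  · simp only [k, k.not_gt, if_true, if_false]; split_ifs <;> simp

/-- The list of entries of a matrix, as a point of affine space `ℂ^(n²)`. -/
def matrixEntries {n : ℕ} (X : Matrix (Fin n) (Fin n) ℂ) : Fin n × Fin n → ℂ :=
  fun p => X p.1 p.2

/-- The ideal of all polynomials in the `n²` matrix entries that vanish on `S`. -/
def matrixIdeal {n : ℕ} (S : Set (Matrix (Fin n) (Fin n) ℂ)) :
    Ideal (MvPolynomial (Fin n × Fin n) ℂ) :=
  MvPolynomial.vanishingIdeal ℂ (matrixEntries '' S)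

/-- The Zariski closure of a set of matrices in `ℂ^(n²)`: the common zeros of all the polynomials
that vanish on the set. -/
def zariskiClosure {n : ℕ} (S : Set (Matrix (Fin n) (Fin n) ℂ)) :
    Set (Matrix (Fin n) (Fin n) ℂ) :=
  {A | matrixEntries A ∈ MvPolynomial.zeroLocus ℂ (matrixIdeal S)}

/-- The dimension of a Zariski closed set of matrices: the Krull dimension of its coordinate
ring. -/
def varietyDim {n : ℕ} (V : Set (Matrix (Fin n) (Fin n) ℂ)) : WithBot ℕ∞ :=
  ringKrullDim (MvPolynomial (Fin n × Fin n) ℂ ⧸ matrixIdeal V)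

/-- The entry `r_{kl}` of the rank-control matrix of `X`: the rank of the upper-left `k × l`
submatrix of `X`. For `1 ≤ k, l ≤ n` these are the entries of `R(X)` in the usual numbering from
one; for `k = 0` the submatrix is empty, so that the value is `0`, which is the added zero row. -/
def rankControl {n : ℕ} (X : Matrix (Fin n) (Fin n) ℂ) (k l : ℕ) : ℕ :=
  (X.submatrix (fun i : {i : Fin n // i.val < k} => i.val)
    (fun j : {j : Fin n // j.val < l} => j.val)).rank

theorem rankControl_zero_left {n : ℕ} (X : Matrix (Fin n) (Fin n) ℂ) (l : ℕ) :
    rankControl X 0 l = 0 := by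
  have h := Matrix.rank_le_card_height (X.submatrix (fun i : {i : Fin n // i.val < 0} => i.val)
    (fun j : {j : Fin n // j.val < l} => j.val))
  simpa [rankControl] using h

/-- The number of pairs `1 ≤ i < j ≤ n` with `r_{ij} = r_{i-1,j-1}`. The elements `i j : Fin n`
are numbered from zero, so they stand for the indices `i + 1` and `j + 1`. -/
def diagonalEqualities {n : ℕ} (X : Matrix (Fin n) (Fin n) ℂ) : ℕ :=
  (Finset.univ.filter fun p : Fin n × Fin n =>
    p.1 < p.2 ∧ rankControl X (p.1.val + 1) (p.2.val + 1) = rankControl X p.1.val p.2.val).card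

/-- A congruence B-orbit of anti-symmetric `n × n` matrices. -/
@[ext]
structure CongruenceBOrbit (n : ℕ) where
  carrier : Set (Matrix (Fin n) (Fin n) ℂ)
  isOrbit : ∃ X ∈ antiSymmetricMatrices n, carrier = congruenceBOrbit X

/-- The orbit of an anti-symmetric matrix, as an element of the set of orbits. -/
def CongruenceBOrbit.of {n : ℕ} (X : Matrix (Fin n) (Fin n) ℂ)
    (hX : X ∈ antiSymmetricMatrices n) : CongruenceBOrbit n :=
  ⟨congruenceBOrbit X, X, hX, rfl⟩

theorem subset_zariskiClosure {n : ℕ} (S : Set (Matrix (Fin n) (Fin n) ℂ)) :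
    S ⊆ zariskiClosure S :=
  fun _ hA _ hp => hp _ ⟨_, hA, rfl⟩

theorem zariskiClosure_subset {n : ℕ} {S T : Set (Matrix (Fin n) (Fin n) ℂ)}
    (h : S ⊆ zariskiClosure T) : zariskiClosure S ⊆ zariskiClosure T := by
  intro A hA p hp
  refine hA p ?_
  rintro _ ⟨X, hX, rfl⟩
  exact h hX p hp

/-- The order on orbits: `O₁ ≤ O₂` when `O₁` is contained in the Zariski closure of `O₂`. -/
instance (n : ℕ) : Preorder (CongruenceBOrbit n) where
  le O₁ O₂ := O₁.carrier ⊆ zariskiClosure O₂.carrier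
  le_refl O := subset_zariskiClosure O.carrier
  le_trans _ _ _ h₁ h₂ := h₁.trans (zariskiClosure_subset h₂)

end

/-! Skew Gaussian elimination by upper-triangular congruences brings every anti-symmetric matrix to
the matrix of an involution. Upper-left ranks are constant on orbits and recover the involution, so
orbits correspond to involutions and are finite in number. On the orbit of `π`, suitable corner
minors are nonzero and the minors bordering them vanish (`det_cornerMatrix_ne_zero`,
`borderedMinor_eq_zero`); these conditions fix all the ranks.

Dimension. The orbit map pulls polynomials back to a polynomial ring, so the vanishing ideal is
prime and the dimension is a transcendence degree. A pair `i < j` is free when the rank grows from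
`r_{i-1,j-1}` to `r_{ij}`. The entries at free positions are independent, since the differential of
the orbit map at the identity has a diagonal nonsingular minor there
(`algebraicIndependent_orbitComorphism`). All other entries are algebraic over them, since at a
non-free position a bordered minor determines the entry from entries with smaller index sum
(`isAlgebraic_apply_of_borderedMinor_eq_zero`). Hence the dimension is the number of free positions,
which is the number of pairs `i < j` minus the number of diagonal equalities.

Grading. An orbit is the locus in its closure where the single polynomial `orbitPolynomial` is
nonzero. By Krull's principal ideal theorem its boundary has pure codimension one, and the boundary
is a finite union of orbit closures. So below any `O₂`, each smaller `O₁` lies under an orbit of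
dimension exactly one less (`exists_intermediate_codim_one`). Strict monotonicity and unit steps
along covers follow formally; the zero orbit is the least element. -/

noncomputable section

/-! ### Dimension theory of affine domains -/

/-- Integral extensions preserve the Krull dimension. -/
theorem ringKrullDim_eq_of_isIntegral (R S : Type*) [CommRing R] [CommRing S] [Algebra R S]
    [Algebra.IsIntegral R S] [FaithfulSMul R S] : ringKrullDim S = ringKrullDim R := by
  apply le_antisymm
  · refine Order.krullDim_le_of_strictMono (PrimeSpectrum.comap (algebraMap R S)) ?_
    intro P Q hPQ
    exact Ideal.IsIntegral.comap_lt_comap (R := R) (I := P.asIdeal) (J := Q.asIdeal) hPQ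
  · refine iSup_le fun l => ?_
    obtain ⟨⟨Q, hQ, hQl⟩⟩ := Ideal.nonempty_primesOver (S := S) l.head.asIdeal
    obtain ⟨L, hL, -⟩ := Ideal.exists_ltSeries_of_hasGoingUp l Q
    rw [← hL]
    exact Order.LTSeries.length_le_krullDim L

/-- The Krull dimension of a finitely generated domain over a field is its transcendence degree. -/
theorem exists_ringKrullDim_eq_trdeg (k A : Type*) [Field k] [CommRing A] [IsDomain A] [Algebra k A]
    [Algebra.FiniteType k A] :
    ∃ d : ℕ, ringKrullDim A = d ∧ Algebra.trdeg k A = d := by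
  obtain ⟨s, g, hg, hint⟩ := exists_integral_inj_algHom_of_fg k A
  algebraize [g.toRingHom]
  have hs : IsScalarTower k (MvPolynomial (Fin s) k) A :=
    IsScalarTower.of_algebraMap_eq fun x => (g.commutes x).symm
  have : Algebra.IsIntegral (MvPolynomial (Fin s) k) A := ⟨hint⟩
  have hf : FaithfulSMul (MvPolynomial (Fin s) k) A :=
    (faithfulSMul_iff_algebraMap_injective _ _).mpr hg
  refine ⟨s, ?_, ?_⟩
  · rw [ringKrullDim_eq_of_isIntegral (MvPolynomial (Fin s) k) A]
    simp
  · have h := _root_.lift_trdeg_add_eq k (MvPolynomial (Fin s) k) A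
    rw [_root_.trdeg_eq_zero (R := MvPolynomial (Fin s) k) (A := A)] at h
    simpa using h.symm

/-- A prime `g` is not constant, so some variable `X i` occurs in it. Nonzero multiples of `g` then
have positive degree in `X i`, so the remaining `s - 1` variables stay algebraically independent
modulo `g`. -/
theorem ringKrullDim_quotient_span_singleton_add_one {k : Type*} [Field k] {s : ℕ}
    {g : MvPolynomial (Fin s) k} (hg : Prime g) :
    (s : WithBot ℕ∞) ≤ ringKrullDim (MvPolynomial (Fin s) k ⧸ Ideal.span {g}) + 1 := by
  classical
  have : (Ideal.span {g}).IsPrime := (Ideal.span_singleton_prime hg.ne_zero).mpr hg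
  obtain ⟨d, hd, hd'⟩ := exists_ringKrullDim_eq_trdeg k (MvPolynomial (Fin s) k ⧸ Ideal.span {g})
  obtain ⟨i, hi⟩ : ∃ i, g.degreeOf i ≠ 0 := by
    by_contra! h
    have hC : g.totalDegree = 0 := by
      rw [MvPolynomial.totalDegree_eq_zero_iff]
      intro m hm x
      have := MvPolynomial.monomial_le_degreeOf x hm
      rw [h x] at this
      omega
    rw [MvPolynomial.totalDegree_eq_zero_iff_eq_C] at hC
    refine hg.not_isUnit ?_
    rw [hC]
    refine (IsUnit.mk0 _ fun h0 => hg.ne_zero ?_).map _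
    rw [hC, h0, MvPolynomial.C_0]
  have hind : AlgebraicIndependent k
      (fun j : {j : Fin s // j ≠ i} => Ideal.Quotient.mkₐ k (Ideal.span {g}) (MvPolynomial.X j.1)) := by
    rw [algebraicIndependent_iff]
    intro q hq
    have hq' : MvPolynomial.rename (Subtype.val : {j : Fin s // j ≠ i} → Fin s) q ∈ Ideal.span {g} := by
      rw [← Ideal.Quotient.eq_zero_iff_mem]
      rw [← hq]
      change Ideal.Quotient.mkₐ k (Ideal.span {g}) _ = _
      rw [MvPolynomial.rename_eq_aeval, ← AlgHom.comp_apply]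
      congr 1
      ext j
      simp
    rw [Ideal.mem_span_singleton] at hq'
    obtain ⟨h, hh⟩ := hq'
    by_contra hq0
    have hr0 : MvPolynomial.rename (Subtype.val : {j : Fin s // j ≠ i} → Fin s) q ≠ 0 := fun h0 =>
      hq0 (MvPolynomial.rename_injective _ Subtype.val_injective (by rw [h0, map_zero]))
    have hh0 : h ≠ 0 := by rintro rfl; simp [hh] at hr0
    have hdeg : MvPolynomial.degreeOf i
        (MvPolynomial.rename (Subtype.val : {j : Fin s // j ≠ i} → Fin s) q) = 0 := by
      rw [MvPolynomial.degreeOf_def, Multiset.count_eq_zero, ← Multiset.mem_toFinset,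
        ← MvPolynomial.vars_def]
      intro hm
      obtain ⟨j, -, hj⟩ := Finset.mem_image.mp (MvPolynomial.vars_rename _ _ hm)
      exact j.2 hj
    rw [hh, MvPolynomial.degreeOf_mul_eq hg.ne_zero hh0] at hdeg
    omega
  have h1 := hind.lift_cardinalMk_le_trdeg
  rw [hd'] at h1
  have h2 : Fintype.card {j : Fin s // j ≠ i} ≤ d := by simpa using h1
  rw [Fintype.card_subtype_compl] at h2
  simp at h2
  rw [hd]
  have : s ≤ d + 1 := by omega
  exact_mod_cast this

/-- In a finitely generated domain over a field, the quotient by a prime of height one has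
codimension one. -/
theorem ringKrullDim_quotient_add_one_of_height_eq_one (k : Type*) {A : Type*} [Field k]
    [CommRing A] [IsDomain A] [Algebra k A] [Algebra.FiniteType k A] (P : Ideal A) [P.IsPrime]
    (hP : P.height = 1) : ringKrullDim (A ⧸ P) + 1 = ringKrullDim A := by
  have hN : IsNoetherianRing A := Algebra.FiniteType.isNoetherianRing k A
  apply le_antisymm
  · obtain ⟨x, hx, hx0⟩ := P.ne_bot_iff.mp (P.ne_bot_of_height_eq_one hP)
    refine ringKrullDim_succ_le_of_surjective (Ideal.Quotient.mk P) Ideal.Quotient.mk_surjective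
      (mem_nonZeroDivisors_of_ne_zero hx0) (Ideal.Quotient.eq_zero_iff_mem.mpr hx)
  -- For the other inequality, Noether normalization and going-down reduce to a height-one prime of
  -- a polynomial ring. There it is principal, by unique factorization.
  obtain ⟨s, g, hg, hint⟩ := exists_integral_inj_algHom_of_fg k A
  algebraize [g.toRingHom]
  set S := MvPolynomial (Fin s) k
  have : Algebra.IsIntegral S A := ⟨hint⟩
  have hf : FaithfulSMul S A := (faithfulSMul_iff_algebraMap_injective _ _).mpr hg
  have hpP := Ideal.height_eq_height_add_of_liesOver_of_hasGoingDown (P.under S) P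
  -- The fibre contributes no height: by integrality `P` is minimal over the extension of its
  -- contraction.
  have h0 : (P.map (Ideal.Quotient.mk ((P.under S).map (algebraMap S A)))).height = 0 := by
    have hm := Ideal.IsIntegral.mem_minimalPrimes_map_under (R := S) P
    have hle : (P.under S).map (algebraMap S A) ≤ P := hm.1.2
    have hpr : (P.map (Ideal.Quotient.mk ((P.under S).map (algebraMap S A)))).IsPrime :=
      Ideal.map_isPrime_of_surjective Ideal.Quotient.mk_surjective (by rwa [Ideal.mk_ker])
    rw [Ideal.height_eq_zero_iff]
    refine ⟨⟨hpr, bot_le⟩, fun Q ⟨hQ, _⟩ hQP => ?_⟩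
    rw [Ideal.map_le_iff_le_comap]
    refine hm.2 ⟨Ideal.IsPrime.comap _, ?_⟩ ?_
    · intro x hx
      rw [Ideal.mem_comap, Ideal.Quotient.eq_zero_iff_mem.mpr hx]
      exact zero_mem _
    · intro x hx
      have := hQP (Ideal.mem_comap.mp hx)
      rwa [Ideal.mem_quotient_iff_mem hle] at this
  rw [h0, add_zero, hP] at hpP
  obtain ⟨x, hxmem, hxp⟩ := Ideal.IsPrime.exists_mem_prime_of_ne_bot
    (inferInstance : (P.under S).IsPrime) (Ideal.ne_bot_of_height_eq_one hpP.symm)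
  have hspan := (P.under S).eq_span_singleton_of_height_eq_one hpP.symm hxmem hxp
  have hfa : FaithfulSMul (S ⧸ P.under S) (A ⧸ P) :=
    (faithfulSMul_iff_algebraMap_injective _ _).mpr
      (Ideal.algebraMap_quotient_injective)
  rw [ringKrullDim_eq_of_isIntegral S A, ringKrullDim_eq_of_isIntegral (S ⧸ P.under S) (A ⧸ P)]
  have := ringKrullDim_quotient_span_singleton_add_one hxp
  rw [hspan]
  simpa [S] using this

/-! ### The Jacobian criterion -/

theorem MvPolynomial.pderiv_aeval {k σ ι : Type*} [CommRing k] [Fintype ι]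
    (f : ι → MvPolynomial σ k) (v : σ) (F : MvPolynomial ι k) :
    pderiv v (aeval f F) = ∑ i, aeval f (pderiv i F) * pderiv v (f i) := by
  classical
  induction F using MvPolynomial.induction_on with
  | C a => simp [MvPolynomial.algebraMap_eq]
  | add p q hp hq => simp only [map_add, hp, hq, add_mul, Finset.sum_add_distrib]
  | mul_X p i hp =>
    simp only [map_mul, aeval_X, Derivation.leibniz, smul_eq_mul, hp, pderiv_X, map_add, add_mul,
      Finset.sum_add_distrib, Finset.mul_sum, mul_assoc]
    simp [Pi.single_apply]

theorem MvPolynomial.eq_C_of_pderiv_eq_zero {k ι : Type*} [Field k] [CharZero k]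
    {F : MvPolynomial ι k} (h : ∀ i, pderiv i F = 0) : F = C (coeff 0 F) := by
  classical
  ext m
  rw [coeff_C]
  split_ifs with hm
  · rw [hm]
  · obtain ⟨i, hi⟩ := Finsupp.ne_iff.mp (Ne.symm hm)
    have hm' : m - Finsupp.single i 1 + Finsupp.single i 1 = m :=
      tsub_add_cancel_of_le (by simpa using Nat.one_le_iff_ne_zero.mpr hi)
    have hc := coeff_pderiv (i := i) F (m - Finsupp.single i 1)
    rw [h i, coeff_zero, hm'] at hc
    rcases mul_eq_zero.mp hc.symm with h0 | h0
    · exact h0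
    · exact absurd h0 (Nat.cast_add_one_ne_zero _)

/-- The Jacobian criterion: polynomials with a nonvanishing minor of maximal size of the Jacobian
matrix are algebraically independent. -/
theorem algebraicIndependent_of_det_pderiv_ne_zero {k σ ι : Type*} [Field k] [CharZero k]
    [Fintype ι] [DecidableEq ι] (f : ι → MvPolynomial σ k) (v : ι → σ)
    (h : (Matrix.of fun p q => MvPolynomial.pderiv (v q) (f p)).det ≠ 0) :
    AlgebraicIndependent k f := by
  rw [algebraicIndependent_iff]
  suffices ∀ N : ℕ, ∀ F : MvPolynomial ι k, F.totalDegree ≤ N → MvPolynomial.aeval f F = 0 →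
      F = 0 from fun F => this _ F le_rfl
  have hC : ∀ F : MvPolynomial ι k, F = MvPolynomial.C (F.coeff 0) → MvPolynomial.aeval f F = 0 →
      F = 0 := by
    intro F hF h0
    rw [hF, MvPolynomial.aeval_C, MvPolynomial.algebraMap_eq, MvPolynomial.C_eq_zero] at h0
    rw [hF, h0, MvPolynomial.C_0]
  intro N
  induction N with
  | zero =>
    intro F hF
    exact hC F (MvPolynomial.totalDegree_eq_zero_iff_eq_C.mp (Nat.le_zero.mp hF))
  | succ N ih =>
    intro F hF h0
    refine hC F (MvPolynomial.eq_C_of_pderiv_eq_zero fun i => ih _ ?_ ?_) h0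
    · refine Finset.sup_le fun m hm => ?_
      rw [MvPolynomial.mem_support_iff, MvPolynomial.coeff_pderiv] at hm
      have hm' := MvPolynomial.le_totalDegree
        (MvPolynomial.mem_support_iff.mpr (left_ne_zero_of_mul hm))
      rw [Finsupp.sum_add_index' (by simp) (by simp)] at hm'
      simp at hm'
      omega
    -- Differentiating the relation `F(f) = 0` puts the vector of partials of `F`, evaluated at `f`,
    -- in the left kernel of a matrix with nonzero determinant. So each partial is again a relation,
    -- of smaller degree.
    · refine congrFun (Matrix.eq_zero_of_vecMul_eq_zero h
        (v := fun i => MvPolynomial.aeval f (MvPolynomial.pderiv i F)) ?_) i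
      ext1 q
      have := MvPolynomial.pderiv_aeval f (v q) F
      rw [h0, map_zero] at this
      simpa [Matrix.vecMul, dotProduct] using this.symm

/-! ### The Borel group and its congruence orbits -/

theorem mem_borelMatrices_of_diag_ne_zero {n : ℕ} {B : Matrix (Fin n) (Fin n) ℂ}
    (h : B.IsUpperTriangular) (hd : ∀ i, B i i ≠ 0) : B ∈ borelMatrices n := by
  refine ⟨h, ?_⟩
  rw [Matrix.isUnit_iff_isUnit_det, Matrix.det_of_isUpperTriangular h, isUnit_iff_ne_zero]
  exact Finset.prod_ne_zero_iff.mpr fun i _ => hd i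

theorem diag_ne_zero_of_mem_borelMatrices {n : ℕ} {B : Matrix (Fin n) (Fin n) ℂ}
    (h : B ∈ borelMatrices n) (i : Fin n) : B i i ≠ 0 := by
  have := h.2
  rw [Matrix.isUnit_iff_isUnit_det, Matrix.det_of_isUpperTriangular h.1, isUnit_iff_ne_zero] at this
  exact Finset.prod_ne_zero_iff.mp this i (Finset.mem_univ i)

theorem one_mem_borelMatrices (n : ℕ) : (1 : Matrix (Fin n) (Fin n) ℂ) ∈ borelMatrices n :=
  ⟨Matrix.blockTriangular_one, isUnit_one⟩

theorem mul_mem_borelMatrices {n : ℕ} {B C : Matrix (Fin n) (Fin n) ℂ} (hB : B ∈ borelMatrices n)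
    (hC : C ∈ borelMatrices n) : B * C ∈ borelMatrices n :=
  ⟨hB.1.mul hC.1, hB.2.mul hC.2⟩

theorem inv_mem_borelMatrices {n : ℕ} {B : Matrix (Fin n) (Fin n) ℂ} (hB : B ∈ borelMatrices n) :
    B⁻¹ ∈ borelMatrices n := by
  have := hB.2.invertible
  exact ⟨Matrix.blockTriangular_inv_of_blockTriangular hB.1, Matrix.isUnit_nonsing_inv_iff.mpr hB.2⟩

theorem mem_congruenceBOrbit_self {n : ℕ} (X : Matrix (Fin n) (Fin n) ℂ) :
    X ∈ congruenceBOrbit X :=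
  ⟨1, one_mem_borelMatrices n, by simp⟩

theorem congruenceBOrbit_subset {n : ℕ} {X Y : Matrix (Fin n) (Fin n) ℂ}
    (h : Y ∈ congruenceBOrbit X) : congruenceBOrbit Y ⊆ congruenceBOrbit X := by
  obtain ⟨B, hB, rfl⟩ := h
  rintro _ ⟨C, hC, rfl⟩
  exact ⟨B * C, mul_mem_borelMatrices hB hC, by simp [Matrix.transpose_mul, Matrix.mul_assoc]⟩

theorem mem_congruenceBOrbit_symm {n : ℕ} {X Y : Matrix (Fin n) (Fin n) ℂ}
    (h : Y ∈ congruenceBOrbit X) : X ∈ congruenceBOrbit Y := by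
  obtain ⟨B, hB, rfl⟩ := h
  have hu : IsUnit B.det := (Matrix.isUnit_iff_isUnit_det B).mp hB.2
  refine ⟨B⁻¹, inv_mem_borelMatrices hB, ?_⟩
  have h1 : (B⁻¹)ᵀ * Bᵀ = 1 := by
    rw [← Matrix.transpose_mul, Matrix.mul_nonsing_inv _ hu, Matrix.transpose_one]
  rw [← Matrix.mul_assoc, ← Matrix.mul_assoc, h1, Matrix.one_mul, Matrix.mul_assoc,
    Matrix.mul_nonsing_inv _ hu, Matrix.mul_one]

theorem congruenceBOrbit_eq_of_mem {n : ℕ} {X Y : Matrix (Fin n) (Fin n) ℂ}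
    (h : Y ∈ congruenceBOrbit X) : congruenceBOrbit Y = congruenceBOrbit X :=
  (congruenceBOrbit_subset h).antisymm (congruenceBOrbit_subset (mem_congruenceBOrbit_symm h))

theorem congruenceBOrbit_subset_antiSymmetric {n : ℕ} {X : Matrix (Fin n) (Fin n) ℂ}
    (hX : X ∈ antiSymmetricMatrices n) : congruenceBOrbit X ⊆ antiSymmetricMatrices n := by
  rintro _ ⟨B, -, rfl⟩
  have hX' : Xᵀ = -X := hX
  change (Bᵀ * X * B)ᵀ = -(Bᵀ * X * B)
  simp [Matrix.transpose_mul, hX', Matrix.mul_assoc]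

theorem antiSymmetric_apply {n : ℕ} {X : Matrix (Fin n) (Fin n) ℂ}
    (hX : X ∈ antiSymmetricMatrices n) (i j : Fin n) : X i j = -X j i :=
  congrFun (congrFun (hX : Xᵀ = -X) j) i

theorem involution_apply_apply {n : ℕ} {π : Equiv.Perm (Fin n)} (h : π * π = 1) (i : Fin n) :
    π (π i) = i := by
  simpa using congrArg (fun σ : Equiv.Perm (Fin n) => σ i) h

/-! ### Normal form: every orbit contains an involution -/

/-- The change of basis which splits off the hyperbolic plane spanned by the basis vectors `i`, `j`
from the basis vectors outside `S`. -/
def splitMatrix {n : ℕ} (X : Matrix (Fin n) (Fin n) ℂ) (S : Finset (Fin n)) (i j : Fin n) :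
    Matrix (Fin n) (Fin n) ℂ :=
  Matrix.of fun a b =>
    if b ∈ S ∨ b = i then (if a = b then 1 else 0)
    else if b = j then (if a = b then (X i j)⁻¹ else 0)
    else (if a = b then 1 else 0) - (if a = j then X i b / X i j else 0)
      - (if a = i then X b j / X i j else 0)

theorem mul_splitMatrix_apply {n : ℕ} (X : Matrix (Fin n) (Fin n) ℂ) (S : Finset (Fin n))
    (i j a b : Fin n) :
    (X * splitMatrix X S i j) a b =
      if b ∈ S ∨ b = i then X a b
      else if b = j then X a b * (X i j)⁻¹
      else X a b - X a j * (X i b / X i j) - X a i * (X b j / X i j) := by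
  simp only [Matrix.mul_apply, splitMatrix, Matrix.of_apply]
  split_ifs <;> simp [mul_sub, Finset.sum_sub_distrib]

/-- Skew Gaussian elimination. `S` holds the indices whose rows are already in normal form, `π`
records the pairs found so far, and `m` bounds the number of indices left. Each step adds either a
zero row or a pivot pair to `S`. -/
theorem exists_involutionMatrix_mem_of_rows {n : ℕ} (m : ℕ) :
    ∀ (S : Finset (Fin n)) (X : Matrix (Fin n) (Fin n) ℂ) (π : Equiv.Perm (Fin n)),
      Sᶜ.card ≤ m → X ∈ antiSymmetricMatrices n → π * π = 1 → (∀ i ∉ S, π i = i) →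
      (∀ i ∈ S, ∀ k, X i k = involutionMatrix π i k) →
      ∃ σ : Equiv.Perm (Fin n), σ * σ = 1 ∧ involutionMatrix σ ∈ congruenceBOrbit X := by
  induction m with
  | zero =>
    intro S X π hm hX hπ hS hrow
    have hS' : S = Finset.univ := by simpa using hm
    refine ⟨π, hπ, ?_⟩
    convert mem_congruenceBOrbit_self X
    ext i k
    exact (hrow i (by simp [hS']) k).symm
  | succ m ih =>
    intro S X π hm hX hπ hS hrow
    by_cases hne : Sᶜ.card ≤ m
    · exact ih S X π hne hX hπ hS hrow
    have hSne : Sᶜ.Nonempty := Finset.card_pos.mp (by omega)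
    obtain ⟨i, hiS, hmin⟩ : ∃ i, i ∉ S ∧ ∀ j, j ∉ S → i ≤ j :=
      ⟨Sᶜ.min' hSne, by simpa using Sᶜ.min'_mem hSne,
        fun j hj => Sᶜ.min'_le j (by simpa using hj)⟩
    have hcard : ∀ S' : Finset (Fin n), S ⊆ S' → i ∈ S' → S'ᶜ.card ≤ m := by
      intro S' hSS hi
      have : S'ᶜ ⊂ Sᶜ := by
        refine Finset.compl_ssubset_compl.mpr ⟨hSS, fun h => hiS (h hi)⟩
      have := Finset.card_lt_card this
      omega
    have hπS : ∀ a ∈ S, π a ∈ S := by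
      intro a ha
      by_contra h
      have := hS _ h
      rw [involution_apply_apply hπ] at this
      exact h (this ▸ ha)
    have hanti := antiSymmetric_apply hX
    have hdiag : ∀ a, X a a = 0 := fun a => self_eq_neg.mp (hanti a a)
    have hSz : ∀ a ∈ S, ∀ b ∉ S, X a b = 0 := by
      intro a ha b hb
      rw [hrow a ha]
      have : π a ≠ b := fun h => hb (h ▸ hπS a ha)
      simp [involutionMatrix, this]
    by_cases hrow0 : ∀ k, X i k = 0
    · refine ih (insert i S) X π (hcard _ (Finset.subset_insert _ _) (Finset.mem_insert_self _ _)) hX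
        hπ (fun a ha => hS a fun h => ha (Finset.mem_insert_of_mem h)) ?_
      intro a ha k
      rcases Finset.mem_insert.mp ha with rfl | ha
      · rw [hrow0]
        by_cases hk : a = k <;> simp [involutionMatrix, hS a hiS, hk]
      · exact hrow a ha k
    push Not at hrow0
    -- Taking `i` least outside `S` and `j` the first nonzero column of row `i` is what makes the
    -- clearing matrix upper triangular: an entry below the diagonal would carry a coefficient `X i
    -- b` with `b < j`, or need an index outside `S` below `i`.
    obtain ⟨j, hj0, hjmin⟩ : ∃ j, X i j ≠ 0 ∧ ∀ b, b < j → X i b = 0 := by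
      classical
      have hne : (Finset.univ.filter fun k => X i k ≠ 0).Nonempty := by
        obtain ⟨k, hk⟩ := hrow0
        exact ⟨k, by simpa using hk⟩
      refine ⟨_, (Finset.mem_filter.mp (Finset.min'_mem _ hne)).2, fun b hb => ?_⟩
      by_contra h
      exact absurd (Finset.min'_le _ b (by simpa using h)) (not_le.mpr hb)
    have hjS : j ∉ S := fun h => hj0 (by rw [hanti, hSz j h i hiS, neg_zero])
    have hij' : i ≠ j := fun h => hj0 (by rw [← h, hdiag])
    have hij : i < j := lt_of_le_of_ne (hmin j hjS) hij'
    set C := splitMatrix X S i j with hCdef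
    have hC : C ∈ borelMatrices n := by
      apply mem_borelMatrices_of_diag_ne_zero
      · intro a b hab
        have hab : b < a := hab
        have hne : a ≠ b := hab.ne'
        simp only [hCdef, splitMatrix, Matrix.of_apply, hne, if_false]
        split_ifs with h1 h2 h3 h4 h5
        · rfl
        · rfl
        · exact absurd (h3.symm.trans h4) hij'.symm
        · rw [hjmin b (h3 ▸ hab)]; simp
        · push Not at h1
          exact absurd (hmin b h1.1) (not_le.mpr (h5 ▸ hab))
        · simp
      · intro a
        simp only [hCdef, splitMatrix, Matrix.of_apply, if_true]
        split_ifs with h1 h2 h3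
        · exact one_ne_zero
        · exact inv_ne_zero hj0
        · push Not at h1
          exact absurd h3 h1.2
        · simp
    set Y := Cᵀ * X * C with hY
    have hYX : Y ∈ congruenceBOrbit X := ⟨C, hC, rfl⟩
    have hYapp : ∀ a b, Y a b = ∑ p, C p a * (X * C) p b := by
      intro a b
      rw [hY, Matrix.mul_assoc, Matrix.mul_apply]
      rfl
    have hYS : ∀ a, a ∈ S ∨ a = i → ∀ b, Y a b = (X * C) a b := by
      intro a ha b
      rw [hYapp, Finset.sum_eq_single a]
      · simp [hCdef, splitMatrix, ha]
      · intro p _ hp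
        simp [hCdef, splitMatrix, ha, hp]
      · simp
    have hYj : ∀ b, Y j b = (X i j)⁻¹ * (X * C) j b := by
      intro b
      rw [hYapp, Finset.sum_eq_single j]
      · simp [hCdef, splitMatrix, hjS, hij'.symm]
      · intro p _ hp
        simp [hCdef, splitMatrix, hjS, hij'.symm, hp]
      · simp
    have hπi := hS i hiS
    have hπj := hS j hjS
    have hsS : ∀ a ∈ S, (Equiv.swap i j * π) a = π a := by
      intro a ha
      have h1 : π a ≠ i := fun h => hiS (h ▸ hπS a ha)
      have h2 : π a ≠ j := fun h => hjS (h ▸ hπS a ha)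
      simp [Equiv.swap_apply_of_ne_of_ne h1 h2]
    have hsi : (Equiv.swap i j * π) i = j := by simp [hπi]
    have hsj : (Equiv.swap i j * π) j = i := by simp [hπj]
    have hso : ∀ a, a ∉ S → a ≠ i → a ≠ j → (Equiv.swap i j * π) a = a := by
      intro a ha h1 h2
      simp [hS a ha, Equiv.swap_apply_of_ne_of_ne h1 h2]
    -- Since `π` fixes both `i` and `j`, multiplying by the swap adds the new pair as a disjoint
    -- transposition.
    obtain ⟨σ, hσ, hmem⟩ := ih (insert i (insert j S)) Y (Equiv.swap i j * π)
      (hcard _ (fun a ha => by simp [ha]) (by simp))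
      (congruenceBOrbit_subset_antiSymmetric hX hYX) (by
        ext1 a
        rw [Equiv.Perm.mul_apply, Equiv.Perm.one_apply]
        by_cases ha : a ∈ S
        · rw [hsS a ha, hsS _ (hπS a ha), involution_apply_apply hπ]
        · by_cases h1 : a = i
          · rw [h1, hsi, hsj]
          · by_cases h2 : a = j
            · rw [h2, hsj, hsi]
            · rw [hso a ha h1 h2, hso a ha h1 h2])
      (by
        intro a ha
        simp only [Finset.mem_insert, not_or] at ha
        exact hso a ha.2.2 ha.1 ha.2.1)
      (by
        intro a ha b
        rcases Finset.mem_insert.mp ha with rfl | ha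
        · rw [hYS a (Or.inr rfl), hCdef, mul_splitMatrix_apply]
          simp only [involutionMatrix, Matrix.of_apply, hsi]
          by_cases hbS : b ∈ S
          · have : j ≠ b := fun h => hjS (h ▸ hbS)
            simp [hbS, this, hanti a b, hSz b hbS a hiS]
          by_cases hbi : b = a
          · simp [hbi, hdiag]
          by_cases hbj : b = j
          · simp [hbj, hij, hij'.symm, hjS, hj0]
          · simp only [hbS, hbi, or_self, if_false, hbj, Ne.symm hbj, hdiag]
            field_simp
            ring
        rcases Finset.mem_insert.mp ha with rfl | ha
        · rw [hYj, hCdef, mul_splitMatrix_apply]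
          simp only [involutionMatrix, Matrix.of_apply, hsj]
          by_cases hbS : b ∈ S
          · have : i ≠ b := fun h => hiS (h ▸ hbS)
            simp [hbS, this, hanti a b, hSz b hbS a hjS]
          by_cases hbi : b = i
          · simp [hbi, hij, hij.not_gt, hanti a i, hj0]
          by_cases hbj : b = a
          · simp [hbj, hdiag, hij'.symm, hij', hjS]
          · simp only [hbS, hbi, or_self, if_false, hbj, Ne.symm hbi, hdiag, hanti a i, hanti a b]
            field_simp
            ring
        · rw [hYS a (Or.inl ha), hCdef, mul_splitMatrix_apply]
          simp only [involutionMatrix, Matrix.of_apply, hsS a ha, hSz a ha i hiS, hSz a ha j hjS]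
          have := hrow a ha b
          simp only [involutionMatrix, Matrix.of_apply] at this
          rw [← this]
          split_ifs with h1 h2
          · rfl
          · rw [h2, hSz a ha j hjS, zero_mul]
          · ring)
    exact ⟨σ, hσ, congruenceBOrbit_subset hYX hmem⟩

/-- Every anti-symmetric matrix is congruent, under the invertible upper-triangular matrices, to
the matrix of an involution. -/
theorem exists_congruenceBOrbit_eq_involutionMatrix {n : ℕ} {X : Matrix (Fin n) (Fin n) ℂ}
    (hX : X ∈ antiSymmetricMatrices n) :
    ∃ π : Equiv.Perm (Fin n), π * π = 1 ∧
      congruenceBOrbit X = congruenceBOrbit (involutionMatrix π) := by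
  obtain ⟨π, hπ, h⟩ := exists_involutionMatrix_mem_of_rows (n := n) n ∅ X 1
    (by simp) hX (by simp) (by simp) (by simp)
  exact ⟨π, hπ, (congruenceBOrbit_eq_of_mem h).symm⟩

/-! ### Corner minors and upper-left ranks -/

/-- The rows of the nonzero entries in the upper-left `k × l` corner of the matrix of `π`. -/
abbrev CornerIndex {n : ℕ} (π : Equiv.Perm (Fin n)) (k l : ℕ) : Type :=
  {i : Fin n // i.val < k ∧ (π i).val < l ∧ π i ≠ i}

/-- The submatrix of `A` on the rows and columns of the nonzero entries in the upper-left `k × l`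
corner of the matrix of `π`. -/
def cornerMatrix {n : ℕ} {R : Type*} (π : Equiv.Perm (Fin n)) (k l : ℕ)
    (A : Matrix (Fin n) (Fin n) R) : Matrix (CornerIndex π k l) (CornerIndex π k l) R :=
  A.submatrix Subtype.val fun i => π i.1

/-- The difference which vanishes when the entry `(a, b)` of `A` is determined by its
`cornerMatrix` and the entries in the same row and column. -/
def borderedMinor {n : ℕ} {R : Type*} [CommRing R] (π : Equiv.Perm (Fin n)) (k l : ℕ)
    (A : Matrix (Fin n) (Fin n) R) (a b : Fin n) : R :=
  (cornerMatrix π k l A).det * A a b -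
    ∑ t : CornerIndex π k l, ∑ s : CornerIndex π k l,
      A a (π t.1) * (cornerMatrix π k l A).adjugate t s * A s.1 b

theorem map_det_cornerMatrix {n : ℕ} {R S : Type*} [CommRing R] [CommRing S] (f : R →+* S)
    (π : Equiv.Perm (Fin n)) (k l : ℕ) (A : Matrix (Fin n) (Fin n) R) :
    f (cornerMatrix π k l A).det = (cornerMatrix π k l (A.map f)).det := by
  rw [RingHom.map_det]; rfl

theorem map_borderedMinor {n : ℕ} {R S : Type*} [CommRing R] [CommRing S] (f : R →+* S)
    (π : Equiv.Perm (Fin n)) (k l : ℕ) (A : Matrix (Fin n) (Fin n) R) (a b : Fin n) :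
    f (borderedMinor π k l A a b) = borderedMinor π k l (A.map f) a b := by
  have h : ∀ t s, f ((cornerMatrix π k l A).adjugate t s) =
      (cornerMatrix π k l (A.map f)).adjugate t s := fun t s => by
    have := congrFun (congrFun (RingHom.map_adjugate f (cornerMatrix π k l A)) t) s
    exact this
  simp [borderedMinor, map_sub, map_mul, map_sum, map_det_cornerMatrix, h]

/-- The nonzero entry in a row of the matrix of an involution, and zero for a fixed point. -/
def involutionSign {n : ℕ} (π : Equiv.Perm (Fin n)) (i : Fin n) : ℂ := involutionMatrix π i (π i)

theorem involutionSign_ne_zero {n : ℕ} {π : Equiv.Perm (Fin n)} {i : Fin n} (h : π i ≠ i) :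
    involutionSign π i ≠ 0 := by
  rcases lt_or_gt_of_ne h with h | h <;> simp [involutionSign, involutionMatrix, h, h.not_gt]

theorem involutionSign_eq_zero {n : ℕ} {π : Equiv.Perm (Fin n)} {i : Fin n} (h : π i = i) :
    involutionSign π i = 0 := by
  simp [involutionSign, involutionMatrix, h]

theorem transpose_mul_involutionMatrix_mul_apply {n : ℕ} (π : Equiv.Perm (Fin n))
    (B : Matrix (Fin n) (Fin n) ℂ) (a b : Fin n) :
    (Bᵀ * involutionMatrix π * B) a b = ∑ i, B i a * involutionSign π i * B (π i) b := by
  rw [Matrix.mul_assoc, Matrix.mul_apply]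
  refine Finset.sum_congr rfl fun i _ => ?_
  rw [Matrix.mul_apply, Finset.sum_eq_single (π i), Matrix.transpose_apply, mul_assoc]
  · rfl
  · intro j _ hj
    simp [involutionMatrix, hj.symm]
  · simp

/-- Upper triangularity of `B` makes an upper-left corner of the product depend only on the same
corner of `π`. Both factorizations below rest on this. -/
theorem transpose_mul_involutionMatrix_mul_apply_of_lt {n : ℕ} (π : Equiv.Perm (Fin n))
    {B : Matrix (Fin n) (Fin n) ℂ} (hB : B.IsUpperTriangular) {k l : ℕ} {a b : Fin n}
    (ha : a.val < k) (hb : b.val < l) :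
    (Bᵀ * involutionMatrix π * B) a b =
      ∑ i : CornerIndex π k l, B i.1 a * involutionSign π i.1 * B (π i.1) b := by
  rw [transpose_mul_involutionMatrix_mul_apply, ← Finset.sum_subtype
    (Finset.univ.filter fun i : Fin n => i.val < k ∧ (π i).val < l ∧ π i ≠ i) (by simp)
    fun i => B i a * involutionSign π i * B (π i) b]
  symm
  refine Finset.sum_filter_of_ne fun i _ hi => ⟨?_, ?_, ?_⟩
  · by_contra h
    exact hi (by rw [hB (show a < i by rw [Fin.lt_def]; omega), zero_mul, zero_mul])
  · by_contra h
    exact hi (by rw [hB (show b < π i by rw [Fin.lt_def]; omega), mul_zero])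
  · intro h
    exact hi (by rw [involutionSign_eq_zero h, mul_zero, zero_mul])

/-- A matrix which is triangular with respect to an injective labelling has as its determinant the
product of its diagonal entries. -/
theorem Matrix.BlockTriangular.det_of_injective {m α R : Type*} [Fintype m] [DecidableEq m]
    [CommRing R] [LinearOrder α] {M : Matrix m m R} {f : m → α} (hf : Function.Injective f)
    (hM : M.BlockTriangular f) : M.det = ∏ i, M i i := by
  let _ : LinearOrder m := LinearOrder.lift' f hf
  have h := Matrix.det_of_isUpperTriangular (M := M) fun i j hij => hM hij
  convert h

theorem cornerMatrix_transpose_mul_involutionMatrix_mul {n : ℕ} (π : Equiv.Perm (Fin n))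
    {B : Matrix (Fin n) (Fin n) ℂ} (hB : B.IsUpperTriangular) (k l : ℕ) :
    cornerMatrix π k l (Bᵀ * involutionMatrix π * B) =
      (B.submatrix Subtype.val Subtype.val : Matrix (CornerIndex π k l) (CornerIndex π k l) ℂ)ᵀ *
        (Matrix.diagonal (fun i : CornerIndex π k l => involutionSign π i.1) *
          B.submatrix (fun i : CornerIndex π k l => π i.1) fun i : CornerIndex π k l => π i.1) := by
  ext s t
  rw [cornerMatrix, Matrix.submatrix_apply,
    transpose_mul_involutionMatrix_mul_apply_of_lt π hB s.2.1 t.2.2.1, Matrix.mul_apply]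
  refine Finset.sum_congr rfl fun i _ => ?_
  simp [Matrix.diagonal_mul, mul_assoc]

theorem det_cornerMatrix_ne_zero {n : ℕ} (π : Equiv.Perm (Fin n))
    {A : Matrix (Fin n) (Fin n) ℂ} (hA : A ∈ congruenceBOrbit (involutionMatrix π)) (k l : ℕ) :
    (cornerMatrix π k l A).det ≠ 0 := by
  obtain ⟨B, hB, rfl⟩ := hA
  have hd := diag_ne_zero_of_mem_borelMatrices hB
  rw [cornerMatrix_transpose_mul_involutionMatrix_mul π hB.1, Matrix.det_mul, Matrix.det_mul,
    Matrix.det_transpose, Matrix.det_diagonal,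
    Matrix.BlockTriangular.det_of_injective (f := fun i : CornerIndex π k l => i.1)
      (M := B.submatrix Subtype.val Subtype.val) Subtype.val_injective fun i j hij => hB.1 hij,
    Matrix.BlockTriangular.det_of_injective (f := fun i : CornerIndex π k l => π i.1)
      (M := B.submatrix (fun i => π i.1) fun i => π i.1) (π.injective.comp Subtype.val_injective) fun i j hij => hB.1 hij]
  refine mul_ne_zero ?_ (mul_ne_zero ?_ ?_) <;> refine Finset.prod_ne_zero_iff.mpr fun i _ => ?_
  · exact hd _
  · exact involutionSign_ne_zero i.2.2.2
  · exact hd _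

/-- A denominator-free Schur complement. With corner `U * P`, the bordering row is `u ᵥ* P`, the
bordering column is `U *ᵥ v` and the entry is `u ⬝ᵥ v`, so the adjugate term collapses to `det (U *
P)` times `u ⬝ᵥ v`. -/
theorem borderedMinor_eq_zero {n : ℕ} (π : Equiv.Perm (Fin n))
    {A : Matrix (Fin n) (Fin n) ℂ} (hA : A ∈ congruenceBOrbit (involutionMatrix π)) {k l : ℕ}
    {a b : Fin n} (ha : a.val < k) (hb : b.val < l) : borderedMinor π k l A a b = 0 := by
  obtain ⟨B, hB, rfl⟩ := hA
  set U : Matrix (CornerIndex π k l) (CornerIndex π k l) ℂ :=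
    (B.submatrix Subtype.val Subtype.val)ᵀ with hU
  set P := Matrix.diagonal (fun i : CornerIndex π k l => involutionSign π i.1) *
          B.submatrix (fun i : CornerIndex π k l => π i.1) (fun i : CornerIndex π k l => π i.1)
    with hP
  have hM : cornerMatrix π k l (Bᵀ * involutionMatrix π * B) = U * P :=
    cornerMatrix_transpose_mul_involutionMatrix_mul π hB.1 k l
  set u : CornerIndex π k l → ℂ := fun i => B i.1 a
  set v : CornerIndex π k l → ℂ := fun i => involutionSign π i.1 * B (π i.1) b
  have hab : (Bᵀ * involutionMatrix π * B) a b = u ⬝ᵥ v := by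
    rw [transpose_mul_involutionMatrix_mul_apply_of_lt π hB.1 ha hb]
    simp [dotProduct, u, v, mul_assoc]
  have hrow : (fun t : CornerIndex π k l => (Bᵀ * involutionMatrix π * B) a (π t.1)) =
      u ᵥ* P := by
    ext1 t
    rw [transpose_mul_involutionMatrix_mul_apply_of_lt π hB.1 ha t.2.2.1]
    simp [Matrix.vecMul, dotProduct, u, hP, Matrix.diagonal_mul, mul_assoc]
  have hcol : (fun t : CornerIndex π k l => (Bᵀ * involutionMatrix π * B) t.1 b) =
      U *ᵥ v := by
    ext1 t
    rw [transpose_mul_involutionMatrix_mul_apply_of_lt π hB.1 t.2.1 hb]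
    simp [Matrix.mulVec, dotProduct, v, hU, mul_assoc]
  have hsum : ∑ t : CornerIndex π k l, ∑ s : CornerIndex π k l,
      (Bᵀ * involutionMatrix π * B) a (π t.1) *
        (cornerMatrix π k l (Bᵀ * involutionMatrix π * B)).adjugate t s *
        (Bᵀ * involutionMatrix π * B) s.1 b =
      (u ᵥ* P) ⬝ᵥ ((U * P).adjugate *ᵥ (U *ᵥ v)) := by
    rw [← hrow, ← hcol, ← hM]
    simp [dotProduct, Matrix.mulVec, Finset.mul_sum, mul_assoc]
  rw [borderedMinor, hsum, hM, hab, sub_eq_zero, Matrix.adjugate_mul_distrib,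
    ← Matrix.dotProduct_mulVec, Matrix.mulVec_mulVec, Matrix.mulVec_mulVec]
  have : P * (P.adjugate * U.adjugate) * U = (U * P).det • (1 : Matrix _ _ ℂ) := by
    rw [← Matrix.mul_assoc, Matrix.mul_assoc, Matrix.adjugate_mul, Matrix.mul_adjugate,
      smul_mul_smul_comm, Matrix.one_mul, Matrix.det_mul U P, mul_comm P.det]
  rw [this, Matrix.smul_mulVec, Matrix.one_mulVec, dotProduct_smul, smul_eq_mul]

/-- The bordered minors factor the upper-left block through the corner rows, which bounds the rank
above; the invertible corner bounds it below. The hypotheses are conditions on minors rather than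
membership in the orbit, so that the result applies to points of the closure. -/
theorem rankControl_eq_card {n : ℕ} (π : Equiv.Perm (Fin n)) {A : Matrix (Fin n) (Fin n) ℂ}
    {k l : ℕ} (hdet : (cornerMatrix π k l A).det ≠ 0)
    (hb : ∀ a b : Fin n, a.val < k → b.val < l → borderedMinor π k l A a b = 0) :
    rankControl A k l = Fintype.card (CornerIndex π k l) := by
  apply le_antisymm
  · set M := cornerMatrix π k l A
    have hfac : A.submatrix (fun i : {i : Fin n // i.val < k} => i.val)
        (fun j : {j : Fin n // j.val < l} => j.val) =
        (Matrix.of fun (i : {i : Fin n // i.val < k}) (s : CornerIndex π k l) =>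
          M.det⁻¹ * ∑ t : CornerIndex π k l, A i.1 (π t.1) * M.adjugate t s) *
        (Matrix.of fun (s : CornerIndex π k l) (j : {j : Fin n // j.val < l}) => A s.1 j.1) := by
      ext i j
      have := sub_eq_zero.mp (hb i.1 j.1 i.2 j.2)
      rw [Finset.sum_comm] at this
      rw [Matrix.mul_apply, Matrix.submatrix_apply, eq_comm]
      simp only [Matrix.of_apply, mul_assoc, Finset.sum_mul, ← Finset.mul_sum] at this ⊢
      rw [← this, inv_mul_cancel_left₀ hdet]
    rw [rankControl, hfac]
    exact (Matrix.rank_mul_le_left _ _).trans (Matrix.rank_le_card_width _)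
  · have h1 : (cornerMatrix π k l A).rank = Fintype.card (CornerIndex π k l) :=
      Matrix.rank_of_det_ne_zero hdet
    rw [← h1, rankControl]
    exact Matrix.rank_submatrix_le (A.submatrix (fun i : {i : Fin n // i.val < k} => i.val)
      (fun j : {j : Fin n // j.val < l} => j.val))
      (fun s : CornerIndex π k l => ⟨s.1, s.2.1⟩) (fun t : CornerIndex π k l => ⟨π t.1, t.2.2.1⟩)

theorem rankControl_of_mem_orbit {n : ℕ} (π : Equiv.Perm (Fin n)) {A : Matrix (Fin n) (Fin n) ℂ}
    (hA : A ∈ congruenceBOrbit (involutionMatrix π)) (k l : ℕ) :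
    rankControl A k l = Fintype.card (CornerIndex π k l) :=
  rankControl_eq_card π (det_cornerMatrix_ne_zero π hA k l)
    fun _ _ ha hb => borderedMinor_eq_zero π hA ha hb

theorem card_cornerIndex_succ_left {n : ℕ} (π : Equiv.Perm (Fin n)) (a : Fin n) (l : ℕ) :
    Fintype.card (CornerIndex π (a.val + 1) l) =
      Fintype.card (CornerIndex π a.val l) + if (π a).val < l ∧ π a ≠ a then 1 else 0 := by
  classical
  simp only [Fintype.card_subtype, Finset.card_filter]
  rw [← Fintype.sum_ite_eq a fun i => if (π i).val < l ∧ π i ≠ i then 1 else 0,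
    ← Finset.sum_add_distrib]
  refine Finset.sum_congr rfl fun i _ => ?_
  have h1 : i.val < a.val + 1 ↔ i.val < a.val ∨ a = i := by
    rw [Fin.ext_iff]; omega
  have h2 : i.val < a.val → ¬ a = i := by
    rw [Fin.ext_iff]; omega
  by_cases h3 : i.val < a.val
  · simp [h1, h3, h2 h3]
  · by_cases h4 : a = i
    · simp [h4]
    · simp [h1, h3, h4]

/-- Differences of counts in consecutive rows tell, for each `l`, whether row `a` has its nonzero
entry among the first `l` columns. This locates `π a`; a row without such an entry is a fixed point.
-/
theorem eq_of_card_cornerIndex_eq {n : ℕ} {π σ : Equiv.Perm (Fin n)}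
    (h : ∀ k l : ℕ, k ≤ n → l ≤ n →
      Fintype.card (CornerIndex π k l) = Fintype.card (CornerIndex σ k l)) : π = σ := by
  ext1 a
  have key : ∀ l ≤ n, ((π a).val < l ∧ π a ≠ a ↔ (σ a).val < l ∧ σ a ≠ a) := by
    intro l hl
    have h1 := h (a.val + 1) l a.2 hl
    rw [card_cornerIndex_succ_left, card_cornerIndex_succ_left, h a.val l a.2.le hl] at h1
    have h2 := Nat.add_left_cancel h1
    split_ifs at h2 <;> tauto
  have h0 := key n le_rfl
  simp only [Fin.is_lt, true_and] at h0
  by_cases hp : π a = a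
  · rw [hp]
    by_contra hne
    exact (h0.mpr (Ne.symm hne)) hp
  · have hs := h0.mp hp
    have h1 := key ((π a).val + 1) (π a).2
    have h2 := key ((σ a).val + 1) (σ a).2
    simp only [ne_eq, hp, hs, not_false_eq_true, and_true] at h1 h2
    ext
    omega

/-! ### Free positions and their number -/

/-- The positions above the diagonal at which the rank-control matrix of `π` grows along the
diagonal. -/
def IsFreePosition {n : ℕ} (π : Equiv.Perm (Fin n)) (p : Fin n × Fin n) : Prop :=
  p.1 < p.2 ∧ ((π p.1 ≠ p.1 ∧ π p.1 ≤ p.2) ∨ (π p.2 ≠ p.2 ∧ π p.2 ≤ p.1))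

theorem card_cornerIndex_comm {n : ℕ} {π : Equiv.Perm (Fin n)} (hπ : π * π = 1) (k l : ℕ) :
    Fintype.card (CornerIndex π k l) = Fintype.card (CornerIndex π l k) := by
  have h := involution_apply_apply hπ
  have hne : ∀ i, π i ≠ i → π (π i) ≠ π i := fun i hi => by rw [h]; exact hi.symm
  exact Fintype.card_congr
    { toFun := fun i => ⟨π i.1, i.2.2.1, by rw [h]; exact i.2.1, hne _ i.2.2.2⟩
      invFun := fun i => ⟨π i.1, i.2.2.1, by rw [h]; exact i.2.1, hne _ i.2.2.2⟩
      left_inv := fun i => Subtype.ext (h _)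
      right_inv := fun i => Subtype.ext (h _) }

/-- The diagonal step is split into adding row `i` and then, by symmetry of the counts, column `j`.
The column contributes when `π j < i`; the case `π j = i` allowed in `IsFreePosition` means `π i =
j` and is already counted by the row. -/
theorem card_cornerIndex_diagonal_eq_iff {n : ℕ} {π : Equiv.Perm (Fin n)} (hπ : π * π = 1)
    {i j : Fin n} (hij : i < j) :
    Fintype.card (CornerIndex π (i.val + 1) (j.val + 1)) =
      Fintype.card (CornerIndex π i.val j.val) ↔ ¬ IsFreePosition π (i, j) := by
  rw [card_cornerIndex_succ_left, card_cornerIndex_comm hπ i.val (j.val + 1),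
    card_cornerIndex_succ_left, card_cornerIndex_comm hπ j.val i.val]
  have hji : π j = i ↔ π i = j :=
    ⟨fun h => by rw [← h, involution_apply_apply hπ], fun h => by
      rw [← h, involution_apply_apply hπ]⟩
  have h1 : (π i).val < j.val + 1 ↔ π i ≤ j := by rw [Fin.le_def]; omega
  have h2 : π j ≤ i ↔ (π j).val < i.val ∨ π j = i := by rw [Fin.le_def, Fin.ext_iff]; omega
  have h3 : π i = j → π i ≤ j ∧ π i ≠ i := fun h => ⟨h.le, by rw [h]; exact hij.ne'⟩
  have key : ∀ (c : ℕ) (P Q : Prop) [Decidable P] [Decidable Q],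
      c + (if P then 1 else 0) + (if Q then 1 else 0) = c ↔ ¬P ∧ ¬Q := by
    intro c P Q _ _
    by_cases hP : P <;> by_cases hQ : Q <;> simp [hP, hQ]; omega
  rw [key]
  simp only [IsFreePosition, hij, true_and, h1, h2, hji]
  tauto

theorem diagonalEqualities_add_card {n : ℕ} {π : Equiv.Perm (Fin n)} (hπ : π * π = 1)
    {X : Matrix (Fin n) (Fin n) ℂ} (hX : X ∈ congruenceBOrbit (involutionMatrix π)) :
    Nat.card {p // IsFreePosition π p} + diagonalEqualities X = (n ^ 2 - n) / 2 := by
  classical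
  have hpairs : (Finset.univ.filter fun p : Fin n × Fin n => p.1 < p.2).card = (n ^ 2 - n) / 2 := by
    have hswap : (Finset.univ.filter fun p : Fin n × Fin n => p.2 < p.1).card =
        (Finset.univ.filter fun p : Fin n × Fin n => p.1 < p.2).card :=
      Finset.card_bij (fun p _ => p.swap) (by simp) (by simp) (by simp)
    have hdiag : (Finset.univ.filter fun p : Fin n × Fin n => p.1 = p.2).card = n := by
      rw [show (Finset.univ.filter fun p : Fin n × Fin n => p.1 = p.2) = Finset.univ.diag by
        ext p; simp, Finset.diag_card, Finset.card_univ, Fintype.card_fin]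
    have htot : (Finset.univ.filter fun p : Fin n × Fin n => p.1 < p.2).card +
        ((Finset.univ.filter fun p : Fin n × Fin n => p.1 = p.2).card +
        (Finset.univ.filter fun p : Fin n × Fin n => p.2 < p.1).card) = n ^ 2 := by
      simp only [Finset.card_filter, ← Finset.sum_add_distrib]
      rw [Finset.sum_congr rfl (g := fun _ => 1)]
      · simp [sq]
      · intro p _
        rcases lt_trichotomy p.1 p.2 with h | h | h
        · simp [h, h.ne, h.not_gt]
        · simp [h]
        · simp [h, h.ne', h.not_gt]
    omega
  rw [← hpairs, Nat.card_eq_fintype_card, Fintype.card_subtype, diagonalEqualities, add_comm,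
    ← Finset.card_union_of_disjoint]
  · congr 1
    ext p
    simp only [Finset.mem_union, Finset.mem_filter, Finset.mem_univ, true_and,
      rankControl_of_mem_orbit π hX]
    constructor
    · rintro (h | h)
      exacts [h.1, h.1]
    · intro h
      rw [card_cornerIndex_diagonal_eq_iff hπ h]
      tauto
  · rw [Finset.disjoint_left]
    intro p hp hp'
    simp only [Finset.mem_filter, Finset.mem_univ, true_and, rankControl_of_mem_orbit π hX] at hp hp'
    exact (card_cornerIndex_diagonal_eq_iff hπ hp.1).mp hp.2 hp'

/-! ### Upper bound: algebraic dependence on the free entries -/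

/-- All entries of a skew-symmetric matrix with the rank conditions of `π` are algebraic over
the entries at the free positions. -/
theorem isAlgebraic_apply_of_borderedMinor_eq_zero {n : ℕ} {π : Equiv.Perm (Fin n)} (hπ : π * π = 1)
    {D A : Type*} [CommRing D] [IsDomain D] [CommRing A] [IsDomain A]
    [Algebra D A] {x : Matrix (Fin n) (Fin n) A} (hskew : ∀ i j, x i j = -x j i)
    (hdiag : ∀ i, x i i = 0) (hdet : ∀ k l, (cornerMatrix π k l x).det ≠ 0)
    (hb : ∀ k l (a b : Fin n), a.val < k → b.val < l → borderedMinor π k l x a b = 0)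
    (hfree : ∀ p, IsFreePosition π p → IsAlgebraic D (x p.1 p.2)) (i j : Fin n) :
    IsAlgebraic D (x i j) := by
  suffices ∀ N : ℕ, ∀ i j : Fin n, i.val + j.val = N → IsAlgebraic D (x i j) from
    this _ i j rfl
  intro N
  induction N using Nat.strong_induction_on with
  | _ N ih =>
  have hlt : ∀ i j : Fin n, i.val + j.val = N → i < j → IsAlgebraic D (x i j) := by
    intro i j hN hij
    by_cases hf : IsFreePosition π (i, j)
    · exact hfree _ hf
    -- A corner row equal to `i`, or a corner column equal to `j`, would make `(i, j)` free. So the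
    -- bordered minor at `(i, j)` involves, besides `x i j`, only entries of smaller index sum.
    have hs : ∀ s : CornerIndex π (i.val + 1) (j.val + 1), s.1.val < i.val := by
      intro s
      refine lt_of_le_of_ne (Nat.lt_succ_iff.mp s.2.1) fun h => hf ⟨hij, Or.inl ?_⟩
      have : s.1 = i := Fin.ext h
      rw [← this]
      exact ⟨s.2.2.2, Fin.le_def.mpr (Nat.lt_succ_iff.mp s.2.2.1)⟩
    have hss : ∀ s : CornerIndex π (i.val + 1) (j.val + 1), (π s.1).val < j.val := by
      intro s
      refine lt_of_le_of_ne (Nat.lt_succ_iff.mp s.2.2.1) fun h => hf ⟨hij, Or.inr ?_⟩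
      have hsj : π s.1 = j := Fin.ext h
      have hjs : π j = s.1 := (congrArg π hsj).symm.trans (involution_apply_apply hπ s.1)
      change π j ≠ j ∧ π j ≤ i
      rw [hjs]
      exact ⟨fun h => s.2.2.2 (hsj.trans h.symm), Fin.le_def.mpr (hs s).le⟩
    have hK : ∀ a b : Fin n, a.val + b.val < N → x a b ∈ Subalgebra.algebraicClosure D A :=
      fun a b hab => ih _ hab a b rfl
    set K := Subalgebra.algebraicClosure D A
    let M : Matrix (CornerIndex π (i.val + 1) (j.val + 1)) (CornerIndex π (i.val + 1) (j.val + 1)) K :=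
      Matrix.of fun s t => ⟨x s.1 (π t.1), hK _ _ (by have := hs s; have := hss t; omega)⟩
    have hM : K.val.toRingHom.mapMatrix M = cornerMatrix π (i.val + 1) (j.val + 1) x := rfl
    have h0 := hb (i.val + 1) (j.val + 1) i j (Nat.lt_succ_self _) (Nat.lt_succ_self _)
    rw [borderedMinor, sub_eq_zero] at h0
    have hdetK : (cornerMatrix π (i.val + 1) (j.val + 1) x).det ∈ K := by
      rw [← hM, ← RingHom.map_det]
      exact (M.det).2
    have hadj : ∀ s t, (cornerMatrix π (i.val + 1) (j.val + 1) x).adjugate s t ∈ K := by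
      intro s t
      rw [← hM, ← RingHom.map_adjugate]
      exact (M.adjugate s t).2
    -- The vanishing bordered minor is linear in `x i j`, with the nonzero algebraic corner
    -- determinant as its coefficient.
    refine IsAlgebraic.of_mul (mem_nonZeroDivisors_of_ne_zero (hdet (i.val + 1) (j.val + 1)))
      hdetK ?_
    rw [h0]
    change _ ∈ K
    refine sum_mem fun t _ => sum_mem fun s _ => mul_mem (mul_mem (hK _ _ ?_) (hadj _ _))
      (hK _ _ ?_)
    · have := hss t; omega
    · have := hs s; omega
  intro i j hN
  rcases lt_trichotomy i j with h | h | h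
  · exact hlt i j hN h
  · rw [h, hdiag]; exact isAlgebraic_zero
  · rw [hskew]; exact (hlt j i (by omega) h).neg

/-! ### Lower bound: the orbit map and its differential -/

/-- The upper-triangular matrix with indeterminate entries. -/
def genericBorel (n : ℕ) : Matrix (Fin n) (Fin n) (MvPolynomial (Fin n × Fin n) ℂ) :=
  Matrix.of fun k l => if k ≤ l then MvPolynomial.X (k, l) else 0

/-- The comorphism of the orbit map `B ↦ Bᵀ * π * B`. -/
def orbitComorphism {n : ℕ} (π : Equiv.Perm (Fin n)) :
    MvPolynomial (Fin n × Fin n) ℂ →ₐ[ℂ] MvPolynomial (Fin n × Fin n) ℂ :=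
  MvPolynomial.aeval fun p => ∑ i, genericBorel n i p.1 * MvPolynomial.C (involutionSign π i) *
    genericBorel n (π i) p.2

/-- The upper-triangular matrix with entries given by a point of affine space. -/
def upperPart {n : ℕ} (x : Fin n × Fin n → ℂ) : Matrix (Fin n) (Fin n) ℂ :=
  Matrix.of fun k l => if k ≤ l then x (k, l) else 0

theorem upperPart_isUpperTriangular {n : ℕ} (x : Fin n × Fin n → ℂ) :
    (upperPart x).IsUpperTriangular := fun i j hij => by
  have hij : j < i := hij
  simp [upperPart, hij.not_ge]

theorem aeval_genericBorel {n : ℕ} (x : Fin n × Fin n → ℂ) (k l : Fin n) :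
    MvPolynomial.aeval x (genericBorel n k l) = upperPart x k l := by
  simp only [genericBorel, upperPart, Matrix.of_apply]
  split_ifs <;> simp

theorem aeval_orbitComorphism {n : ℕ} (π : Equiv.Perm (Fin n)) (x : Fin n × Fin n → ℂ)
    (p : MvPolynomial (Fin n × Fin n) ℂ) :
    MvPolynomial.aeval x (orbitComorphism π p) =
      MvPolynomial.aeval (matrixEntries ((upperPart x)ᵀ * involutionMatrix π * upperPart x)) p := by
  rw [orbitComorphism, ← AlgHom.comp_apply, MvPolynomial.comp_aeval]
  congr 2
  ext1 p
  rw [matrixEntries, transpose_mul_involutionMatrix_mul_apply]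
  simp only [map_sum, map_mul, aeval_genericBorel, MvPolynomial.aeval_C, Algebra.algebraMap_self,
    RingHom.id_apply]

/-- Invertible matrices are dense among the upper-triangular ones, so vanishing on the orbit means
that the pullback is the zero polynomial. Primality of the ideal follows, the target being a domain.
-/
theorem matrixIdeal_congruenceBOrbit {n : ℕ} (π : Equiv.Perm (Fin n)) :
    matrixIdeal (congruenceBOrbit (involutionMatrix π)) = RingHom.ker (orbitComorphism π) := by
  ext p
  rw [RingHom.mem_ker]
  constructor
  · intro hp
    -- The product of the diagonal variables kills the points that give singular matrices.
    have h0 : orbitComorphism π p * ∏ i : Fin n, MvPolynomial.X (i, i) = 0 := by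
      refine MvPolynomial.funext fun x => ?_
      rw [map_zero, map_mul, map_prod]
      by_cases hx : ∃ i : Fin n, x (i, i) = 0
      · obtain ⟨i, hi⟩ := hx
        rw [Finset.prod_eq_zero (Finset.mem_univ i) (by simpa using hi), mul_zero]
      · push Not at hx
        have hB : upperPart x ∈ borelMatrices n :=
          mem_borelMatrices_of_diag_ne_zero (upperPart_isUpperTriangular x)
            fun i => by simpa [upperPart] using hx i
        have := aeval_orbitComorphism π x p
        rw [hp _ ⟨_, ⟨_, hB, rfl⟩, rfl⟩] at this
        rw [← MvPolynomial.coe_aeval_eq_eval, RingHom.coe_coe, this, zero_mul]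
    refine (mul_eq_zero.mp h0).resolve_right ?_
    exact Finset.prod_ne_zero_iff.mpr fun i _ => MvPolynomial.X_ne_zero _
  · rintro hp _ ⟨_, ⟨B, hB, rfl⟩, rfl⟩
    have := aeval_orbitComorphism π (matrixEntries B) p
    rw [hp, map_zero] at this
    have hup : upperPart (matrixEntries B) = B := by
      ext i j
      by_cases h : i ≤ j
      · simp [upperPart, matrixEntries, h]
      · simp [upperPart, h, hB.1 (not_le.mp h)]
    rw [hup] at this
    exact this.symm

instance matrixIdeal_congruenceBOrbit_isPrime {n : ℕ} (π : Equiv.Perm (Fin n)) :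
    (matrixIdeal (congruenceBOrbit (involutionMatrix π))).IsPrime := by
  rw [matrixIdeal_congruenceBOrbit]
  exact RingHom.ker_isPrime _

open Classical in
/-- The entry of the triangular matrix which moves the entry at a free position. -/
def freeDirection {n : ℕ} (π : Equiv.Perm (Fin n)) (p : Fin n × Fin n) : Fin n × Fin n :=
  if π p.2 ≠ p.2 ∧ π p.2 ≤ p.1 then (π p.2, p.1) else (π p.1, p.2)

theorem pderiv_genericBorel {n : ℕ} (v : Fin n × Fin n) (hv : v.1 ≤ v.2) (k l : Fin n) :
    MvPolynomial.pderiv v (genericBorel n k l) = if v = (k, l) then 1 else 0 := by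
  classical
  simp only [genericBorel, Matrix.of_apply]
  split_ifs with h1 h2 h2
  · rw [h2, MvPolynomial.pderiv_X_self]
  · exact MvPolynomial.pderiv_X_of_ne (Ne.symm h2)
  · subst h2; exact absurd hv h1
  · simp

/-- The differential at the identity sends `E` to `Eᵀ * M + M * E`, with `M` the matrix of `π`; the
two summands are these terms for the elementary matrix `E` at `v`. -/
theorem aeval_one_pderiv_orbitComorphism {n : ℕ} (π : Equiv.Perm (Fin n))
    (v : Fin n × Fin n) (hv : v.1 ≤ v.2) (p : Fin n × Fin n) :
    MvPolynomial.aeval (matrixEntries (1 : Matrix (Fin n) (Fin n) ℂ))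
      (MvPolynomial.pderiv v (orbitComorphism π (MvPolynomial.X p))) =
      (if v.2 = p.1 ∧ π v.1 = p.2 then involutionSign π v.1 else 0) +
        (if v.1 = π p.1 ∧ v.2 = p.2 then involutionSign π p.1 else 0) := by
  have hup : upperPart (matrixEntries (1 : Matrix (Fin n) (Fin n) ℂ)) = 1 := by
    ext i j
    simp only [upperPart, matrixEntries, Matrix.of_apply, Matrix.one_apply]
    split_ifs with h1 h2 h2 <;> first | rfl | exact absurd h2.le h1
  simp only [orbitComorphism, MvPolynomial.aeval_X, map_sum, Derivation.leibniz, smul_eq_mul,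
    pderiv_genericBorel v hv, MvPolynomial.pderiv_C, map_add, map_mul, aeval_genericBorel, hup,
    apply_ite (MvPolynomial.aeval (matrixEntries (1 : Matrix (Fin n) (Fin n) ℂ))), map_one,
    map_zero, MvPolynomial.aeval_C, Finset.sum_add_distrib, mul_zero, zero_add,
    Matrix.one_apply, Prod.ext_iff]
  rw [add_comm]
  congr 1
  · rw [Finset.sum_eq_single v.1]
    · by_cases h1 : v.2 = p.1 <;> by_cases h2 : π v.1 = p.2 <;> simp [h1, h2]
    · intro i _ hi
      simp [Ne.symm hi]
    · simp
  · rw [Finset.sum_eq_single p.1]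
    · by_cases h1 : v.1 = π p.1 <;> by_cases h2 : v.2 = p.2 <;> simp [h1, h2]
    · intro i _ hi
      simp [hi]
    · simp

/-- Freeness of a position says that an upper-triangular elementary direction moves its entry. Among
positions above the diagonal that direction moves no other entry, so the Jacobian minor at the
identity is diagonal with nonzero entries. -/
theorem algebraicIndependent_orbitComorphism {n : ℕ} {π : Equiv.Perm (Fin n)} (hπ : π * π = 1) :
    AlgebraicIndependent ℂ fun p : {p // IsFreePosition π p} =>
      orbitComorphism π (MvPolynomial.X p.1) := by
  classical
  have h := involution_apply_apply hπ
  refine algebraicIndependent_of_det_pderiv_ne_zero _ (fun p => freeDirection π p.1) fun hdet => ?_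
  have h0 := congrArg (MvPolynomial.aeval (matrixEntries (1 : Matrix (Fin n) (Fin n) ℂ))) hdet
  rw [map_zero, AlgHom.map_det] at h0
  revert h0
  have hmat : (MvPolynomial.aeval (matrixEntries (1 : Matrix (Fin n) (Fin n) ℂ))).mapMatrix
      (Matrix.of fun p q : {p // IsFreePosition π p} => MvPolynomial.pderiv (freeDirection π q.1)
        (orbitComorphism π (MvPolynomial.X p.1))) =
      Matrix.diagonal fun p : {p // IsFreePosition π p} =>
        if π p.1.2 ≠ p.1.2 ∧ π p.1.2 ≤ p.1.1 then involutionSign π (π p.1.2)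
        else involutionSign π p.1.1 := by
    ext p q
    obtain ⟨⟨i, j⟩, hp⟩ := p
    obtain ⟨⟨a, b⟩, hq⟩ := q
    have hij : i < j := hp.1
    have hab : a < b := hq.1
    rw [AlgHom.mapMatrix_apply, Matrix.map_apply, Matrix.of_apply, Matrix.diagonal_apply]
    simp only [Subtype.mk.injEq, Prod.mk.injEq]
    by_cases hc : π b ≠ b ∧ π b ≤ a
    · rw [freeDirection, if_pos hc, aeval_one_pderiv_orbitComorphism π _ hc.2]
      simp only [h]
      have h2 : ¬ (π b = π i ∧ a = j) := by
        rintro ⟨h1, rfl⟩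
        rw [π.injective h1] at hab
        exact absurd hab hij.not_gt
      rw [if_neg h2, add_zero]
      by_cases hpq : i = a ∧ j = b
      · obtain ⟨rfl, rfl⟩ := hpq
        simp [hc]
      · rw [if_neg hpq, if_neg fun h' => hpq ⟨h'.1.symm, h'.2.symm⟩]
    · have hc' : π a ≠ a ∧ π a ≤ b := hq.2.resolve_right hc
      rw [freeDirection, if_neg hc, aeval_one_pderiv_orbitComorphism π _ hc'.2]
      simp only [h]
      have h2 : ¬ (b = i ∧ a = j) := by
        rintro ⟨rfl, rfl⟩
        exact absurd hab hij.not_gt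
      rw [if_neg h2, zero_add]
      by_cases hpq : i = a ∧ j = b
      · obtain ⟨rfl, rfl⟩ := hpq
        simp [hc]
      · rw [if_neg hpq, if_neg fun h' => hpq ⟨(π.injective h'.1).symm, h'.2.symm⟩]
  rw [hmat, Matrix.det_diagonal]
  refine Finset.prod_ne_zero_iff.mpr fun p _ => ?_
  split_ifs with hc
  · exact involutionSign_ne_zero (by rw [h]; exact hc.1.symm)
  · exact involutionSign_ne_zero (p.2.2.resolve_right hc).1

/-! ### Vanishing ideals and the dimension of an orbit closure -/

theorem matrixIdeal_zariskiClosure {n : ℕ} (S : Set (Matrix (Fin n) (Fin n) ℂ)) :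
    matrixIdeal (zariskiClosure S) = matrixIdeal S := by
  apply le_antisymm
  · exact MvPolynomial.vanishingIdeal_anti_mono (Set.image_mono (subset_zariskiClosure S))
  · rintro p hp _ ⟨A, hA, rfl⟩
    exact hA p hp

theorem zariskiClosure_subset_iff {n : ℕ} (S T : Set (Matrix (Fin n) (Fin n) ℂ)) :
    S ⊆ zariskiClosure T ↔ matrixIdeal T ≤ matrixIdeal S := by
  constructor
  · intro h
    rw [← matrixIdeal_zariskiClosure T]
    exact MvPolynomial.vanishingIdeal_anti_mono (Set.image_mono h)
  · intro h A hA p hp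
    exact h hp _ ⟨A, hA, rfl⟩

/-- The matrix of coordinate functions. -/
def coordinateMatrix (n : ℕ) : Matrix (Fin n) (Fin n) (MvPolynomial (Fin n × Fin n) ℂ) :=
  Matrix.of fun i j => MvPolynomial.X (i, j)

theorem coordinateMatrix_map_aeval {n : ℕ} (A : Matrix (Fin n) (Fin n) ℂ) :
    (coordinateMatrix n).map ((MvPolynomial.aeval (R := ℂ) (matrixEntries A)).toRingHom) = A := by
  ext i j
  simp [coordinateMatrix, matrixEntries]

theorem aeval_det_cornerMatrix {n : ℕ} (π : Equiv.Perm (Fin n)) (k l : ℕ)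
    (A : Matrix (Fin n) (Fin n) ℂ) :
    MvPolynomial.aeval (matrixEntries A) (cornerMatrix π k l (coordinateMatrix n)).det =
      (cornerMatrix π k l A).det := by
  have := map_det_cornerMatrix (MvPolynomial.aeval (R := ℂ) (matrixEntries A)).toRingHom π k l
    (coordinateMatrix n)
  rwa [coordinateMatrix_map_aeval] at this

theorem aeval_borderedMinor {n : ℕ} (π : Equiv.Perm (Fin n)) (k l : ℕ) (a b : Fin n)
    (A : Matrix (Fin n) (Fin n) ℂ) :
    MvPolynomial.aeval (matrixEntries A) (borderedMinor π k l (coordinateMatrix n) a b) =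
      borderedMinor π k l A a b := by
  have := map_borderedMinor (MvPolynomial.aeval (R := ℂ) (matrixEntries A)).toRingHom π k l
    (coordinateMatrix n) a b
  rwa [coordinateMatrix_map_aeval] at this

theorem det_cornerMatrix_notMem_matrixIdeal {n : ℕ} (π : Equiv.Perm (Fin n)) (k l : ℕ) :
    (cornerMatrix π k l (coordinateMatrix n)).det ∉
      matrixIdeal (congruenceBOrbit (involutionMatrix π)) := fun h => by
  have := h _ ⟨_, mem_congruenceBOrbit_self _, rfl⟩
  rw [aeval_det_cornerMatrix] at this
  exact det_cornerMatrix_ne_zero π (mem_congruenceBOrbit_self _) k l this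

theorem borderedMinor_mem_matrixIdeal {n : ℕ} (π : Equiv.Perm (Fin n)) {k l : ℕ} {a b : Fin n}
    (ha : a.val < k) (hb : b.val < l) : borderedMinor π k l (coordinateMatrix n) a b ∈
      matrixIdeal (congruenceBOrbit (involutionMatrix π)) := by
  rintro _ ⟨A, hA, rfl⟩
  rw [aeval_borderedMinor]
  exact borderedMinor_eq_zero π hA ha hb

/-- The coordinates at free positions form a transcendence basis of the coordinate ring: independent
by the Jacobian minor, and generating up to algebraic elements by the bordered minors. -/
theorem ringKrullDim_quotient_matrixIdeal {n : ℕ} {π : Equiv.Perm (Fin n)} (hπ : π * π = 1) :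
    ringKrullDim (MvPolynomial (Fin n × Fin n) ℂ ⧸
      matrixIdeal (congruenceBOrbit (involutionMatrix π))) =
      (Nat.card {p // IsFreePosition π p} : WithBot ℕ∞) := by
  classical
  set I := matrixIdeal (congruenceBOrbit (involutionMatrix π)) with hI
  set A := MvPolynomial (Fin n × Fin n) ℂ ⧸ I
  obtain ⟨d, hd, hd'⟩ := exists_ringKrullDim_eq_trdeg ℂ A
  have hker : I = RingHom.ker (orbitComorphism π) := matrixIdeal_congruenceBOrbit π
  set x : Matrix (Fin n) (Fin n) A := (coordinateMatrix n).map (Ideal.Quotient.mk I) with hx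
  have hind : AlgebraicIndependent ℂ fun p : {p // IsFreePosition π p} => x p.1.1 p.1.2 := by
    let φ : A →ₐ[ℂ] MvPolynomial (Fin n × Fin n) ℂ :=
      Ideal.Quotient.liftₐ I (orbitComorphism π) fun a ha => by rwa [hker] at ha
    refine AlgebraicIndependent.of_comp φ ?_
    exact algebraicIndependent_orbitComorphism hπ
  have hanti := congruenceBOrbit_subset_antiSymmetric (involutionMatrix_mem hπ)
  have halg : Algebra.IsAlgebraic
      (Algebra.adjoin ℂ (Set.range fun p : {p // IsFreePosition π p} => x p.1.1 p.1.2)) A := by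
    set D := Algebra.adjoin ℂ (Set.range fun p : {p // IsFreePosition π p} => x p.1.1 p.1.2)
    have hent : ∀ i j, IsAlgebraic D (x i j) := by
      refine isAlgebraic_apply_of_borderedMinor_eq_zero hπ ?_ ?_ ?_ ?_ ?_
      · intro i j
        rw [← sub_eq_zero, sub_neg_eq_add]
        refine Ideal.Quotient.eq_zero_iff_mem.mpr (?_ : coordinateMatrix n i j +
          coordinateMatrix n j i ∈ I)
        rintro _ ⟨Y, hY, rfl⟩
        have := antiSymmetric_apply (hanti hY) i j
        simp [coordinateMatrix, matrixEntries, this]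
      · intro i
        refine Ideal.Quotient.eq_zero_iff_mem.mpr (?_ : coordinateMatrix n i i ∈ I)
        rintro _ ⟨Y, hY, rfl⟩
        have := self_eq_neg.mp (antiSymmetric_apply (hanti hY) i i)
        simp [coordinateMatrix, matrixEntries, this]
      · intro k l
        rw [← map_det_cornerMatrix, ne_eq, Ideal.Quotient.eq_zero_iff_mem]
        exact det_cornerMatrix_notMem_matrixIdeal π k l
      · intro k l a b ha hb
        rw [← map_borderedMinor, Ideal.Quotient.eq_zero_iff_mem]
        exact borderedMinor_mem_matrixIdeal π ha hb
      · intro p hp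
        have : x p.1 p.2 ∈ D := Algebra.subset_adjoin ⟨⟨p, hp⟩, rfl⟩
        exact isAlgebraic_algebraMap (⟨_, this⟩ : D)
    refine ⟨fun a => ?_⟩
    obtain ⟨q, rfl⟩ := Ideal.Quotient.mk_surjective a
    change _ ∈ Subalgebra.algebraicClosure D A
    induction q using MvPolynomial.induction_on with
    | C c => exact (Subalgebra.algebraicClosure D A).algebraMap_mem (algebraMap ℂ D c)
    | add p q hp hq => rw [map_add]; exact add_mem hp hq
    | mul_X p i hp => rw [map_mul]; exact mul_mem hp (hent i.1 i.2)
  have hfs : FaithfulSMul ℂ A := inferInstance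
  have hle := hind.lift_cardinalMk_le_trdeg
  have hge := Algebra.IsAlgebraic.trdeg_le_cardinalMk ℂ
    (Set.range fun p : {p // IsFreePosition π p} => x p.1.1 p.1.2)
  rw [hd'] at hle hge
  have hge' := hge.trans Cardinal.mk_range_le
  have h1 : Nat.card {p // IsFreePosition π p} ≤ d := by simpa using hle
  have h2 : d ≤ Nat.card {p // IsFreePosition π p} := by simpa using hge'
  rw [hd, le_antisymm h1 h2]

/-! ### The boundary of an orbit -/

theorem eq_of_mem_congruenceBOrbit {n : ℕ} {π σ : Equiv.Perm (Fin n)}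
    {A : Matrix (Fin n) (Fin n) ℂ} (hπ : A ∈ congruenceBOrbit (involutionMatrix π))
    (hσ : A ∈ congruenceBOrbit (involutionMatrix σ)) : π = σ :=
  eq_of_card_cornerIndex_eq fun k l _ _ => by
    rw [← rankControl_of_mem_orbit π hπ, ← rankControl_of_mem_orbit σ hσ]

/-- A polynomial whose nonvanishing set cuts out the orbit of `π` in its closure. -/
def orbitPolynomial {n : ℕ} (π : Equiv.Perm (Fin n)) : MvPolynomial (Fin n × Fin n) ℂ :=
  ∏ k ∈ Finset.range (n + 1), ∏ l ∈ Finset.range (n + 1),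
    (cornerMatrix π k l (coordinateMatrix n)).det

theorem aeval_orbitPolynomial_ne_zero_iff {n : ℕ} (π : Equiv.Perm (Fin n))
    (A : Matrix (Fin n) (Fin n) ℂ) :
    MvPolynomial.aeval (matrixEntries A) (orbitPolynomial π) ≠ 0 ↔
      ∀ k l, k ≤ n → l ≤ n → (cornerMatrix π k l A).det ≠ 0 := by
  simp only [orbitPolynomial, map_prod, aeval_det_cornerMatrix, Finset.prod_ne_zero_iff,
    Finset.mem_range, Nat.lt_succ_iff]
  exact ⟨fun h k l hk hl => h k hk l hl, fun h k hk l hl => h k l hk hl⟩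

theorem aeval_orbitPolynomial_ne_zero {n : ℕ} {π : Equiv.Perm (Fin n)}
    {A : Matrix (Fin n) (Fin n) ℂ} (hA : A ∈ congruenceBOrbit (involutionMatrix π)) :
    MvPolynomial.aeval (matrixEntries A) (orbitPolynomial π) ≠ 0 :=
  (aeval_orbitPolynomial_ne_zero_iff π A).mpr fun k l _ _ => det_cornerMatrix_ne_zero π hA k l

theorem orbitPolynomial_notMem {n : ℕ} (π : Equiv.Perm (Fin n)) :
    orbitPolynomial π ∉ matrixIdeal (congruenceBOrbit (involutionMatrix π)) := fun h =>
  aeval_orbitPolynomial_ne_zero (mem_congruenceBOrbit_self _)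
    (h _ ⟨_, mem_congruenceBOrbit_self _, rfl⟩)

theorem zariskiClosure_subset_antiSymmetric {n : ℕ} {S : Set (Matrix (Fin n) (Fin n) ℂ)}
    (hS : S ⊆ antiSymmetricMatrices n) : zariskiClosure S ⊆ antiSymmetricMatrices n := by
  intro A hA
  ext i j
  have := hA (coordinateMatrix n j i + coordinateMatrix n i j) (by
    rintro _ ⟨Y, hY, rfl⟩
    have := antiSymmetric_apply (hS hY) i j
    simp [coordinateMatrix, matrixEntries, this])
  simpa [coordinateMatrix, matrixEntries, add_eq_zero_iff_eq_neg] using this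

/-- The orbit of an involution is the locus in its closure where `orbitPolynomial` is nonzero. -/
theorem mem_orbit_of_mem_zariskiClosure {n : ℕ} {π : Equiv.Perm (Fin n)} (hπ : π * π = 1)
    {A : Matrix (Fin n) (Fin n) ℂ} (hA : A ∈ zariskiClosure (congruenceBOrbit (involutionMatrix π)))
    (hf : MvPolynomial.aeval (matrixEntries A) (orbitPolynomial π) ≠ 0) :
    A ∈ congruenceBOrbit (involutionMatrix π) := by
  rw [aeval_orbitPolynomial_ne_zero_iff] at hf
  have hanti := zariskiClosure_subset_antiSymmetric
    (congruenceBOrbit_subset_antiSymmetric (involutionMatrix_mem hπ)) hA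
  obtain ⟨σ, hσ, hAσ⟩ := exists_congruenceBOrbit_eq_involutionMatrix hanti
  have hmem : A ∈ congruenceBOrbit (involutionMatrix σ) := hAσ ▸ mem_congruenceBOrbit_self A
  -- The bordered minors of `π` vanish on the whole closure. Together with the nonzero corners they
  -- give `A` the ranks of `π`, and ranks determine the involution.
  have : π = σ := eq_of_card_cornerIndex_eq fun k l hk hl => by
    rw [← rankControl_of_mem_orbit σ hmem, rankControl_eq_card π (hf k l hk hl)]
    intro a b ha hb
    rw [← aeval_borderedMinor]
    exact hA _ (borderedMinor_mem_matrixIdeal π ha hb)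
  rwa [this]

/-- Congruence by a fixed `B` is a polynomial map preserving the orbit, hence also its closure. -/
theorem congruenceBOrbit_subset_zariskiClosure {n : ℕ} {X Y : Matrix (Fin n) (Fin n) ℂ}
    (hY : Y ∈ zariskiClosure (congruenceBOrbit X)) :
    congruenceBOrbit Y ⊆ zariskiClosure (congruenceBOrbit X) := by
  rintro _ ⟨B, hB, rfl⟩ p hp
  let φ : MvPolynomial (Fin n × Fin n) ℂ →ₐ[ℂ] MvPolynomial (Fin n × Fin n) ℂ :=
    MvPolynomial.aeval fun q =>
      ((B.map MvPolynomial.C)ᵀ * coordinateMatrix n * B.map MvPolynomial.C :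
        Matrix (Fin n) (Fin n) (MvPolynomial (Fin n × Fin n) ℂ)) q.1 q.2
  have hφ : ∀ A : Matrix (Fin n) (Fin n) ℂ, MvPolynomial.aeval (matrixEntries A) (φ p) =
      MvPolynomial.aeval (matrixEntries (Bᵀ * A * B)) p := by
    intro A
    rw [← AlgHom.comp_apply, MvPolynomial.comp_aeval]
    congr 2
    ext1 q
    simp [Matrix.mul_apply, coordinateMatrix, matrixEntries]
  rw [← hφ]
  refine hY _ ?_
  rintro _ ⟨A, hA, rfl⟩
  rw [hφ]
  exact hp _ ⟨_, congruenceBOrbit_subset hA ⟨B, hB, rfl⟩, rfl⟩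

/-- If the closures agree, the orbit of `π` is dense in that of `σ`, so it meets the open locus
where `orbitPolynomial σ` is nonzero, which is the orbit of `σ`. -/
theorem eq_of_matrixIdeal_eq {n : ℕ} {π σ : Equiv.Perm (Fin n)} (hσ : σ * σ = 1)
    (h : matrixIdeal (congruenceBOrbit (involutionMatrix π)) =
      matrixIdeal (congruenceBOrbit (involutionMatrix σ))) : π = σ := by
  have hf := orbitPolynomial_notMem σ
  rw [← h] at hf
  obtain ⟨A, hA, hAf⟩ : ∃ A ∈ congruenceBOrbit (involutionMatrix π),
      MvPolynomial.aeval (matrixEntries A) (orbitPolynomial σ) ≠ 0 := by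
    by_contra! hc
    refine hf ?_
    rintro _ ⟨A, hA, rfl⟩
    exact hc A hA
  exact eq_of_mem_congruenceBOrbit hA (mem_orbit_of_mem_zariskiClosure hσ
    ((zariskiClosure_subset_iff _ _).mpr h.ge hA) hAf)

/-- The boundary of an orbit has pure codimension one: every smaller orbit is contained in the
closure of an orbit of codimension one. -/
theorem exists_intermediate_codim_one {n : ℕ} {π σ : Equiv.Perm (Fin n)} (hπ : π * π = 1)
    (hne : σ ≠ π) (hle : matrixIdeal (congruenceBOrbit (involutionMatrix π)) ≤
      matrixIdeal (congruenceBOrbit (involutionMatrix σ))) :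
    ∃ τ : Equiv.Perm (Fin n), τ * τ = 1 ∧ τ ≠ π ∧
      matrixIdeal (congruenceBOrbit (involutionMatrix π)) ≤
        matrixIdeal (congruenceBOrbit (involutionMatrix τ)) ∧
      matrixIdeal (congruenceBOrbit (involutionMatrix τ)) ≤
        matrixIdeal (congruenceBOrbit (involutionMatrix σ)) ∧
      ringKrullDim (MvPolynomial (Fin n × Fin n) ℂ ⧸
        matrixIdeal (congruenceBOrbit (involutionMatrix τ))) + 1 =
      ringKrullDim (MvPolynomial (Fin n × Fin n) ℂ ⧸
        matrixIdeal (congruenceBOrbit (involutionMatrix π))) := by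
  classical
  let I : Equiv.Perm (Fin n) → Ideal (MvPolynomial (Fin n × Fin n) ℂ) := fun τ =>
    matrixIdeal (congruenceBOrbit (involutionMatrix τ))
  -- The zero locus of `J` is the boundary of the orbit of `π`; `P` below is an irreducible
  -- component of it containing the orbit of `σ`.
  set J := I π ⊔ Ideal.span {orbitPolynomial π} with hJ
  have hJI : ∀ τ, τ ≠ π → I π ≤ I τ → J ≤ I τ := by
    intro τ hτ hle
    refine sup_le hle ((Ideal.span_singleton_le_iff_mem _).mpr ?_)
    rintro _ ⟨A, hA, rfl⟩
    by_contra hc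
    exact hτ (eq_of_mem_congruenceBOrbit hA (mem_orbit_of_mem_zariskiClosure hπ
      ((zariskiClosure_subset_iff _ _).mpr hle hA) hc))
  obtain ⟨P, hP, hPσ⟩ := Ideal.exists_minimalPrimes_le (hJI σ hne hle)
  have hPp : P.IsPrime := hP.1.1
  set T : Finset (Equiv.Perm (Fin n)) := Finset.univ.filter fun τ => τ * τ = 1 ∧ τ ≠ π ∧ I π ≤ I τ
  -- By the Nullstellensatz the radical of `J` contains every polynomial vanishing on all boundary
  -- orbits. As these are finite in number and `P` is prime, `P` contains the ideal of one of them,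
  -- and by minimality equals it.
  have hTP : T.inf I ≤ P := by
    refine le_trans ?_ (hPp.radical_le_iff.mpr hP.1.2)
    rw [← MvPolynomial.vanishingIdeal_zeroLocus_eq_radical (K := ℂ)]
    intro p hp x hx
    set A : Matrix (Fin n) (Fin n) ℂ := Matrix.of fun i j => x (i, j)
    have hxA : x = matrixEntries A := rfl
    rw [hxA] at hx ⊢
    have hAπ : A ∈ zariskiClosure (congruenceBOrbit (involutionMatrix π)) :=
      fun q hq => hx q (Ideal.mem_sup_left hq)
    have hAf := hx _ (Ideal.mem_sup_right (Ideal.mem_span_singleton_self (orbitPolynomial π)))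
    obtain ⟨τ, hτ, hAτ⟩ := exists_congruenceBOrbit_eq_involutionMatrix
      (zariskiClosure_subset_antiSymmetric
        (congruenceBOrbit_subset_antiSymmetric (involutionMatrix_mem hπ)) hAπ)
    have hmem : A ∈ congruenceBOrbit (involutionMatrix τ) := hAτ ▸ mem_congruenceBOrbit_self A
    have hτT : τ ∈ T := by
      refine Finset.mem_filter.mpr ⟨Finset.mem_univ _, hτ, ?_, ?_⟩
      · rintro rfl
        exact aeval_orbitPolynomial_ne_zero hmem hAf
      · refine (zariskiClosure_subset_iff _ _).mp ?_
        rw [← hAτ]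
        exact congruenceBOrbit_subset_zariskiClosure hAπ
    exact Finset.inf_le (f := I) hτT hp _ ⟨A, hmem, rfl⟩
  obtain ⟨τ, hτT, hτP⟩ := hPp.inf_le'.mp hTP
  obtain ⟨hτ, hτπ, hπτ⟩ := (Finset.mem_filter.mp hτT).2
  have hPτ : P = I τ := le_antisymm
    (hP.2 ⟨matrixIdeal_congruenceBOrbit_isPrime τ, hJI τ hτπ hπτ⟩ hτP) hτP
  refine ⟨τ, hτ, hτπ, hπτ, hPτ.ge.trans hPσ, ?_⟩
  change ringKrullDim (_ ⧸ I τ) + 1 = ringKrullDim (_ ⧸ I π)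
  rw [← hPτ]
  have hIP : I π ≤ P := le_sup_left.trans hP.1.2
  have hprime : (I π).IsPrime := matrixIdeal_congruenceBOrbit_isPrime π
  have hpr : (P.map (Ideal.Quotient.mk (I π))).IsPrime :=
    Ideal.map_isPrime_of_surjective Ideal.Quotient.mk_surjective (by rwa [Ideal.mk_ker])
  -- Krull's principal ideal theorem in the coordinate ring of the closure; the height is not zero
  -- because `orbitPolynomial π` is nonzero there.
  have hheight : (P.map (Ideal.Quotient.mk (I π))).height = 1 := by
    refine le_antisymm (Ideal.map_height_le_one_of_mem_minimalPrimes hP) ?_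
    rw [Order.one_le_iff_ne_zero, ne_eq, Ideal.height_eq_zero_iff_eq_bot]
    intro h0
    have hfP : orbitPolynomial π ∈ P :=
      hP.1.2 (Ideal.mem_sup_right (Ideal.mem_span_singleton_self _))
    have := Ideal.mem_map_of_mem (Ideal.Quotient.mk (I π)) hfP
    rw [h0, Ideal.mem_bot, Ideal.Quotient.eq_zero_iff_mem] at this
    exact orbitPolynomial_notMem π this
  rw [← ringKrullDim_quotient_add_one_of_height_eq_one ℂ _ hheight,
    ringKrullDim_eq_of_ringEquiv (DoubleQuot.quotQuotEquivQuotOfLE hIP)]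

/-- Scalar matrices `t • 1` move `X` along the curve `t ^ 2 • X`, which stays in the orbit for `t ≠
0` and reaches zero at `t = 0`. -/
theorem zero_mem_zariskiClosure_congruenceBOrbit {n : ℕ} (X : Matrix (Fin n) (Fin n) ℂ) :
    0 ∈ zariskiClosure (congruenceBOrbit X) := by
  intro p hp
  let q : Polynomial ℂ := MvPolynomial.aeval (fun ij : Fin n × Fin n =>
    Polynomial.X ^ 2 * Polynomial.C (X ij.1 ij.2)) p
  have hq : ∀ t : ℂ, q.eval t = MvPolynomial.aeval (matrixEntries (t ^ 2 • X)) p := by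
    intro t
    rw [← Polynomial.coe_aeval_eq_eval, ← AlgHom.comp_apply,
      MvPolynomial.comp_aeval]
    congr 2
    ext1 ij
    simp [matrixEntries]
    ring
  have h0 : q * Polynomial.X = 0 := by
    refine Polynomial.funext fun t => ?_
    by_cases ht : t = 0
    · simp [ht]
    · have hB : t • (1 : Matrix (Fin n) (Fin n) ℂ) ∈ borelMatrices n := by
        refine mem_borelMatrices_of_diag_ne_zero (fun i j hij => ?_) fun i => by simpa using ht
        have hij : j < i := hij
        simp [Matrix.one_apply_ne hij.ne']
      rw [Polynomial.eval_mul, hq, hp _ ⟨_, ⟨_, hB, ?_⟩, rfl⟩, zero_mul, Polynomial.eval_zero]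
      simp [smul_smul, sq]
  have hq0 := (mul_eq_zero.mp h0).resolve_right Polynomial.X_ne_zero
  have := hq 0
  rw [hq0, Polynomial.eval_zero] at this
  simpa using this.symm

/-! ### The graded poset of orbits -/

/-- The involution of a congruence orbit. -/
theorem CongruenceBOrbit.exists_involution {n : ℕ} (O : CongruenceBOrbit n) :
    ∃ π : Equiv.Perm (Fin n), π * π = 1 ∧ O.carrier = congruenceBOrbit (involutionMatrix π) := by
  obtain ⟨X, hX, hO⟩ := O.isOrbit
  obtain ⟨π, hπ, h⟩ := exists_congruenceBOrbit_eq_involutionMatrix hX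
  exact ⟨π, hπ, hO.trans h⟩

theorem CongruenceBOrbit.le_iff {n : ℕ} {O₁ O₂ : CongruenceBOrbit n} :
    O₁ ≤ O₂ ↔ matrixIdeal O₂.carrier ≤ matrixIdeal O₁.carrier :=
  zariskiClosure_subset_iff _ _

theorem CongruenceBOrbit.le_antisymm {n : ℕ} {O₁ O₂ : CongruenceBOrbit n} (h₁ : O₁ ≤ O₂)
    (h₂ : O₂ ≤ O₁) : O₁ = O₂ := by
  obtain ⟨π, -, h1⟩ := O₁.exists_involution
  obtain ⟨σ, hσ, h2⟩ := O₂.exists_involution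
  rw [CongruenceBOrbit.le_iff, h1, h2] at h₁ h₂
  ext1
  rw [h1, h2, eq_of_matrixIdeal_eq hσ (h₂.antisymm h₁)]

/-- The dimension of the closure of a congruence orbit. -/
def CongruenceBOrbit.rank {n : ℕ} (O : CongruenceBOrbit n) : ℕ :=
  Nat.card {p // IsFreePosition O.exists_involution.choose p}

/-- The involution of an orbit is unique, so the choice made in `CongruenceBOrbit.rank` is
immaterial. -/
theorem CongruenceBOrbit.rank_eq {n : ℕ} {O : CongruenceBOrbit n} {π : Equiv.Perm (Fin n)}
    (h : O.carrier = congruenceBOrbit (involutionMatrix π)) :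
    O.rank = Nat.card {p // IsFreePosition π p} := by
  have hs := O.exists_involution.choose_spec.2
  have : O.exists_involution.choose = π := eq_of_mem_congruenceBOrbit
    (A := involutionMatrix π) (by rw [← hs, h]; exact mem_congruenceBOrbit_self _)
    (mem_congruenceBOrbit_self _)
  rw [CongruenceBOrbit.rank, this]

theorem CongruenceBOrbit.varietyDim_eq_rank {n : ℕ} (O : CongruenceBOrbit n) :
    varietyDim (zariskiClosure O.carrier) = (O.rank : WithBot ℕ∞) := by
  obtain ⟨π, hπ, h⟩ := O.exists_involution
  rw [varietyDim, matrixIdeal_zariskiClosure, CongruenceBOrbit.rank_eq h, h,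
    ringKrullDim_quotient_matrixIdeal hπ]

theorem CongruenceBOrbit.rank_add_diagonalEqualities {n : ℕ} {O : CongruenceBOrbit n}
    {X : Matrix (Fin n) (Fin n) ℂ} (hX : X ∈ O.carrier) :
    O.rank + diagonalEqualities X = (n ^ 2 - n) / 2 := by
  obtain ⟨π, hπ, h⟩ := O.exists_involution
  rw [CongruenceBOrbit.rank_eq h]
  exact diagonalEqualities_add_card hπ (h ▸ hX)

theorem CongruenceBOrbit.rank_mono {n : ℕ} {O₁ O₂ : CongruenceBOrbit n} (h : O₁ ≤ O₂) :
    O₁.rank ≤ O₂.rank := by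
  have h1 := O₁.varietyDim_eq_rank
  have h2 := O₂.varietyDim_eq_rank
  rw [varietyDim, matrixIdeal_zariskiClosure] at h1 h2
  have := ringKrullDim_le_of_surjective (Ideal.Quotient.factor (CongruenceBOrbit.le_iff.mp h))
    (Ideal.Quotient.factor_surjective _)
  rw [h1, h2] at this
  exact_mod_cast this

/-- The order-theoretic form of pure codimension one. With weak monotonicity of the rank it gives
strict monotonicity; for a cover, the intermediate orbit must be `O₁` itself. -/
theorem CongruenceBOrbit.exists_intermediate {n : ℕ} {O₁ O₂ : CongruenceBOrbit n} (h : O₁ < O₂) :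
    ∃ O : CongruenceBOrbit n, O₁ ≤ O ∧ O < O₂ ∧ O.rank + 1 = O₂.rank := by
  obtain ⟨σ, hσ, h1⟩ := O₁.exists_involution
  obtain ⟨π, hπ, h2⟩ := O₂.exists_involution
  have hne : σ ≠ π := by
    rintro rfl
    exact h.ne (CongruenceBOrbit.ext (h1.trans h2.symm))
  obtain ⟨τ, hτ, hτπ, hle, hle', hdim⟩ := exists_intermediate_codim_one hπ hne (by
    rw [← h1, ← h2]; exact CongruenceBOrbit.le_iff.mp h.le)
  let O := CongruenceBOrbit.of (involutionMatrix τ) (involutionMatrix_mem hτ)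
  have hO : O.carrier = congruenceBOrbit (involutionMatrix τ) := rfl
  refine ⟨O, CongruenceBOrbit.le_iff.mpr (by rwa [h1, hO]), lt_of_le_not_ge
    (CongruenceBOrbit.le_iff.mpr (by rwa [h2, hO])) fun hc => hτπ ?_, ?_⟩
  · rw [CongruenceBOrbit.le_iff, h2, hO] at hc
    exact (eq_of_matrixIdeal_eq hτ (hle.antisymm hc)).symm
  · rw [ringKrullDim_quotient_matrixIdeal hτ, ringKrullDim_quotient_matrixIdeal hπ,
      ← CongruenceBOrbit.rank_eq hO, ← CongruenceBOrbit.rank_eq h2] at hdim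
    exact_mod_cast hdim

/-- The graded order on the congruence orbits given by the dimension. -/
abbrev CongruenceBOrbit.gradeMinOrder (n : ℕ) : GradeMinOrder ℕ (CongruenceBOrbit n) where
  grade := CongruenceBOrbit.rank
  grade_strictMono O₁ O₂ h := by
    obtain ⟨O, h1, -, h2⟩ := CongruenceBOrbit.exists_intermediate h
    have := CongruenceBOrbit.rank_mono h1
    omega
  covBy_grade O₁ O₂ h := by
    obtain ⟨O, h1, h2, h3⟩ := CongruenceBOrbit.exists_intermediate h.lt
    have h4 : O ≤ O₁ := by
      by_contra hc
      exact h.2 (lt_of_le_not_ge h1 hc) h2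
    rw [Order.covBy_iff_add_one_eq, CongruenceBOrbit.le_antisymm h1 h4, h3]
  isMin_grade O hO := by
    -- The identity has the zero matrix, whose orbit lies below every orbit, so a minimal orbit is
    -- this one; it has no free positions.
    let Z := CongruenceBOrbit.of (involutionMatrix (1 : Equiv.Perm (Fin n)))
      (involutionMatrix_mem (one_mul 1))
    have hZ : involutionMatrix (1 : Equiv.Perm (Fin n)) = 0 := by
      ext i j
      by_cases hij : i = j <;> simp [involutionMatrix, hij]
    have hZO : Z ≤ O := by
      obtain ⟨X, -, hX⟩ := O.isOrbit
      rintro _ ⟨B, -, rfl⟩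
      rw [hZ, Matrix.mul_zero, Matrix.zero_mul, hX]
      exact zero_mem_zariskiClosure_congruenceBOrbit X
    have hr : O.rank = 0 := by
      have : IsEmpty {p // IsFreePosition (1 : Equiv.Perm (Fin n)) p} :=
        ⟨fun p => p.2.2.elim (fun h => h.1 rfl) fun h => h.1 rfl⟩
      rw [← CongruenceBOrbit.le_antisymm hZO (hO hZO), CongruenceBOrbit.rank_eq (O := Z) rfl,
        Nat.card_of_isEmpty]
    rw [hr]
    exact isMin_bot

end

/-- The dimension of the closure of the congruence B-orbit of an involution, and the rank function
of the poset of all orbits. `GradeMinOrder ℕ` is a function to `ℕ` that is strictly monotone, goes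
up by one along covering relations and is zero at minimal elements. -/
theorem mainTheorem1 (n : ℕ) :
    (∀ π : Equiv.Perm (Fin n), π * π = 1 →
      varietyDim (zariskiClosure (congruenceBOrbit (involutionMatrix π))) +
        (diagonalEqualities (involutionMatrix π) : WithBot ℕ∞) =
          (((n ^ 2 - n) / 2 : ℕ) : WithBot ℕ∞)) ∧
    (∀ O₁ O₂ : CongruenceBOrbit n, O₁ ≤ O₂ → O₂ ≤ O₁ → O₁ = O₂) ∧
    (∃ G : GradeMinOrder ℕ (CongruenceBOrbit n),
      ∀ (X : Matrix (Fin n) (Fin n) ℂ) (hX : X ∈ antiSymmetricMatrices n),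
        varietyDim (zariskiClosure (congruenceBOrbit X)) =
            ((G.grade (CongruenceBOrbit.of X hX) : ℕ) : WithBot ℕ∞) ∧
          G.grade (CongruenceBOrbit.of X hX) + diagonalEqualities X = (n ^ 2 - n) / 2) := by
  refine ⟨fun π hπ => ?_, fun _ _ => CongruenceBOrbit.le_antisymm,
    CongruenceBOrbit.gradeMinOrder n, fun X hX => ⟨?_, ?_⟩⟩
  · have h1 := (CongruenceBOrbit.of _ (involutionMatrix_mem hπ)).varietyDim_eq_rank
    have h2 := CongruenceBOrbit.rank_add_diagonalEqualities
      (O := CongruenceBOrbit.of _ (involutionMatrix_mem hπ)) (mem_congruenceBOrbit_self _)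
    rw [← h2, Nat.cast_add, ← h1]
    rfl
  · exact (CongruenceBOrbit.of X hX).varietyDim_eq_rank
  · exact CongruenceBOrbit.rank_add_diagonalEqualities (O := CongruenceBOrbit.of X hX)
      (mem_congruenceBOrbit_self X)
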